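/- Let $\Theta\subset\mathbb R$ be compact, with upper Minkowski dimension $$\beta(\Theta)=\limsup_{\delta\to0^+}\frac{\log N(\delta)}{-\log\delta},$$ where $N(\delta)$ is the minimal number of closed balls of diameter $\delta$ needed to cover $\Theta$. Let $0<\alpha<1$, $C_1\ge1$, $C_2,C_3>0$, and let $\gamma:\mathbb R\times[0,1]\times\Theta\to\mathbb R$ satisfy $\gamma(x,0,\theta)=x$ and, for all $x,x'\in\mathbb R$, $t,t'\in[0,1]$, $\theta,\theta'\in\Theta$: (C1) $x\mapsto\gamma(x,t,\theta)$ is $C^1$ and $C_1^{-1}|x-x'|\le|\gamma(x,t,\theta)-\gamma(x',t,\theta)|\le C_1|x-x'|$; (C2) $|\gamma(x,t,\theta)-\gamma(x,t',\theta)|\le C_2|t-t'|^\alpha$; (C3) $|\gamma(x,t,\theta)-\gamma(x,t,\theta')|\le C_3|\theta-\theta'|$. For $f\in L^2(\mathbb R)$ let $\hat f(\xi)=\int e^{-ix\xi}f(x)\,dx$ (extended to $L^2$), $\|f\|_{H^s}=\|(1+|\xi|^2)^{s/2}\hat f\|_{L^2}$ (so $f\in H^s(\mathbb R)$, $s\ge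 0$, means that this is finite), and $$e^{it\Delta}f(y)=\frac1{2\pi}\int_{\mathbb R}e^{i(y\xi+t\xi^2)}\hat f(\xi)\,d\xi ,$$ where the integral is understood as $\lim_{k\to\infty}\int_{|\xi|\le2^k}$; it is the ordinary Lebesgue integral if $\hat f$ is integrable. Let $x_0\in\mathbb R$, $r>0$, and consider, for $f\in H^s(\mathbb R)$, the maximal estimate $$\Bigl\|\sup_{t\in(0,1),\,\theta\in\Theta}|e^{it\Delta}f(\gamma(x,t,\theta))|\Bigr\|_{L^p_x(B(x_0,r))}\le C\|f\|_{H^s(\mathbb R)},\tag{$*$}$$ which is meant to include that for almost every $x\in B(x_0,r)$ the values $e^{it\Delta}f(\gamma(x,t,\theta))$, $t\in(0,1)$, $\theta\in\Theta$, are all defined, and that the supremum is a measurable function of $x$ (up to a null set). Then: (1) if $\alpha\in[1/2,1)$, then $(*)$ holds for $s>\frac{\beta(\Theta)+1}{4}$ and $p=4$; (2) if $\alpha\in(1/4,1/2)$, then $(*)$ holds for $s>\frac{\beta(\Theta)+1}{4}$ and $p=8\alpha$; (3) if $\alpha\in(0,1/4]$, then $(*)$ holds for $s>\alpha\beta(\Theta)+\frac12-\alpha$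 and $p=2$. Here $C$ depends only on $\alpha,s,C_1,C_2,C_3,\Theta$ and $B(x_0,r)$; in particular it depends neither on $f$ nor otherwise on $\gamma$. -/

import Mathlib

open MeasureTheory Filter Topology
open scoped FourierTransform NNReal ENNReal

noncomputable section

namespace SchrodingerCurves

/-- The minimal number of closed balls of diameter `δ` (closed intervals of length `δ`, with
arbitrary centres) that cover `Θ ⊆ ℝ`; for compact `Θ` and `δ > 0` this number is finite. -/
def coverCount (Θ : Set ℝ) (δ : ℝ) : ℕ :=
  (Metric.externalCoveringNumber (δ / 2).toNNReal Θ).toNat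

/-- The upper Minkowski dimension `limsup_{δ → 0⁺} log N(δ) / (- log δ)`. The quotient is bounded
near `0` when `Θ ⊆ ℝ` is bounded, so the real `limsup` is the genuine one for compact `Θ`. -/
def upperMinkowskiDim (Θ : Set ℝ) : ℝ :=
  limsup (fun δ : ℝ => Real.log (coverCount Θ δ) / (-Real.log δ)) (𝓝[>] (0 : ℝ))

/-- The Fourier transform `f̂(ξ) = ∫ e^{-ixξ} f(x) dx` of `f ∈ L²(ℝ)`, obtained from Mathlib's
`L²` Fourier transform (whose kernel is `e^{-2πixξ}`) by rescaling the frequency variable. -/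
def hat (f : Lp ℂ 2 (volume : Measure ℝ)) (ξ : ℝ) : ℂ :=
  (𝓕 f : Lp ℂ 2 (volume : Measure ℝ)) (ξ / (2 * Real.pi))

/-- The norm `‖f‖_{H^s} = ‖(1 + |ξ|²)^{s/2} f̂‖_{L²}`, with value `∞` if `f ∉ H^s(ℝ)`. -/
def sobolevNorm (s : ℝ) (f : Lp ℂ 2 (volume : Measure ℝ)) : ℝ≥0∞ :=
  eLpNorm (fun ξ : ℝ => (((1 + ξ ^ 2) ^ (s / 2) : ℝ) : ℂ) * hat f ξ) 2 volume

/-- For `s ≥ 0`: `f ∈ L²(ℝ)` belongs to `H^s(ℝ)`. -/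
def MemH (s : ℝ) (f : Lp ℂ 2 (volume : Measure ℝ)) : Prop :=
  sobolevNorm s f < ∞

/-- The part of `e^{itΔ} f (y) = (2π)⁻¹ ∫ e^{i(yξ + tξ²)} f̂(ξ) dξ` from frequencies
`|ξ| ≤ 2 ^ k`; the integral converges absolutely for every `f ∈ L²(ℝ)`. -/
def schrodingerTrunc (f : Lp ℂ 2 (volume : Measure ℝ)) (k : ℕ) (t y : ℝ) : ℂ :=
  (2 * Real.pi : ℂ)⁻¹ *
    ∫ ξ in Set.Icc (-(2 : ℝ) ^ k) ((2 : ℝ) ^ k),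
      Complex.exp (Complex.I * ((y * ξ + t * ξ ^ 2 : ℝ) : ℂ)) * hat f ξ

/-- `e^{itΔ} f (y) = (2π)⁻¹ ∫ e^{i(yξ + tξ²)} f̂(ξ) dξ`, the integral being the limit of the
integrals over `|ξ| ≤ 2 ^ k` (meaningful where that limit exists). It is the ordinary Lebesgue
integral whenever `f̂` is integrable, see `schrodinger_eq_integral`. -/
def schrodinger (f : Lp ℂ 2 (volume : Measure ℝ)) (t y : ℝ) : ℂ :=
  limUnder atTop fun k : ℕ => schrodingerTrunc f k t y

/-- The limit that defines `e^{itΔ} f (y)` exists. -/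
def SchrodingerDefinedAt (f : Lp ℂ 2 (volume : Measure ℝ)) (t y : ℝ) : Prop :=
  ∃ z : ℂ, Tendsto (fun k : ℕ => schrodingerTrunc f k t y) atTop (𝓝 z)

theorem tendsto_schrodingerTrunc_of_integrable (f : Lp ℂ 2 (volume : Measure ℝ))
    (hf : Integrable (hat f)) (t y : ℝ) :
    Tendsto (fun k : ℕ => schrodingerTrunc f k t y) atTop
      (𝓝 ((2 * Real.pi : ℂ)⁻¹ *
        ∫ ξ : ℝ, Complex.exp (Complex.I * ((y * ξ + t * ξ ^ 2 : ℝ) : ℂ)) * hat f ξ)) := by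
  have hpow : Tendsto (fun k : ℕ => (2 : ℝ) ^ k) atTop atTop :=
    tendsto_pow_atTop_atTop_of_one_lt one_lt_two
  have hcov : AECover (volume : Measure ℝ) atTop
      fun k : ℕ => Set.Icc (-(2 : ℝ) ^ k) ((2 : ℝ) ^ k) :=
    aecover_Icc (tendsto_neg_atTop_atBot.comp hpow) hpow
  refine Tendsto.const_mul _ (hcov.integral_tendsto_of_countably_generated ?_)
  refine hf.bdd_mul (c := 1) ?_ ?_
  · exact Continuous.aestronglyMeasurable (by fun_prop)
  · filter_upwards with ξ
    rw [mul_comm, Complex.norm_exp_ofReal_mul_I]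

theorem schrodinger_eq_integral (f : Lp ℂ 2 (volume : Measure ℝ))
    (hf : Integrable (hat f)) (t y : ℝ) :
    schrodinger f t y = (2 * Real.pi : ℂ)⁻¹ *
      ∫ ξ : ℝ, Complex.exp (Complex.I * ((y * ξ + t * ξ ^ 2 : ℝ) : ℂ)) * hat f ξ :=
  (tendsto_schrodingerTrunc_of_integrable f hf t y).limUnder_eq

/-- The conditions on a map `γ : ℝ × [0,1] × Θ → ℝ`, `(x, t, θ) ↦ γ x t θ` (values of `γ` outside
this domain are irrelevant): `γ x 0 θ = x`; `C¹` and bi-Lipschitz in `x` with constant `C₁`;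
`α`-Hölder in `t` with constant `C₂`; Lipschitz in `θ` with constant `C₃`. -/
structure IsCurveFamily (Θ : Set ℝ) (α C₁ C₂ C₃ : ℝ) (γ : ℝ → ℝ → ℝ → ℝ) : Prop where
  initial : ∀ x, ∀ θ ∈ Θ, γ x 0 θ = x
  contDiff : ∀ t ∈ Set.Icc (0 : ℝ) 1, ∀ θ ∈ Θ, ContDiff ℝ 1 fun x => γ x t θ
  bilipschitz : ∀ x x', ∀ t ∈ Set.Icc (0 : ℝ) 1, ∀ θ ∈ Θ,
    C₁⁻¹ * |x - x'| ≤ |γ x t θ - γ x' t θ| ∧ |γ x t θ - γ x' t θ| ≤ C₁ * |x - x'|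
  holder : ∀ x, ∀ t ∈ Set.Icc (0 : ℝ) 1, ∀ t' ∈ Set.Icc (0 : ℝ) 1, ∀ θ ∈ Θ,
    |γ x t θ - γ x t' θ| ≤ C₂ * |t - t'| ^ α
  lipschitz : ∀ x, ∀ t ∈ Set.Icc (0 : ℝ) 1, ∀ θ ∈ Θ, ∀ θ' ∈ Θ,
    |γ x t θ - γ x t θ'| ≤ C₃ * |θ - θ'|

/-- `x ↦ sup_{t ∈ (0,1), θ ∈ Θ} |e^{itΔ} f (γ(x,t,θ))|`. -/
def maximalFunction (Θ : Set ℝ) (γ : ℝ → ℝ → ℝ → ℝ) (f : Lp ℂ 2 (volume : Measure ℝ))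
    (x : ℝ) : ℝ≥0∞ :=
  ⨆ t ∈ Set.Ioo (0 : ℝ) 1, ⨆ θ ∈ Θ, ‖schrodinger f t (γ x t θ)‖ₑ

/-- The maximal estimate on `B(x₀, r)`, with a constant that serves all `γ` with the given
constants and all `f ∈ H^s(ℝ)`. It includes that, for almost every `x` in the ball, all the values
`e^{itΔ} f (γ(x,t,θ))` in the supremum are defined, and that the supremum is measurable. -/
def MaximalEstimate (Θ : Set ℝ) (α C₁ C₂ C₃ x₀ r s : ℝ) (p : ℝ≥0∞) : Prop :=
  ∃ C : ℝ≥0, ∀ γ : ℝ → ℝ → ℝ → ℝ, IsCurveFamily Θ α C₁ C₂ C₃ γ →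
    ∀ f : Lp ℂ 2 (volume : Measure ℝ), MemH s f →
      (∀ᵐ x ∂(volume.restrict (Metric.ball x₀ r)), ∀ t ∈ Set.Ioo (0 : ℝ) 1, ∀ θ ∈ Θ,
        SchrodingerDefinedAt f t (γ x t θ)) ∧
      AEMeasurable (maximalFunction Θ γ f) (volume.restrict (Metric.ball x₀ r)) ∧
      eLpNorm (maximalFunction Θ γ f) p (volume.restrict (Metric.ball x₀ r)) ≤
        C * sobolevNorm s f

end SchrodingerCurves

end

namespace SchrodingerCurves

/-! Split the frequencies into a low part |ξ| ≤ 1 and dyadic annuli |ξ| ∼ ℓ = 2ⁿ, and prove a bound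
for each annulus with a power of ℓ smaller than the one that the Sobolev weight pays for.

On one annulus, cover Θ by pieces of diameter ℓ^{-m}. On a piece, a measurable choice of nearly
optimal (t, θ) for each x turns the supremum into a linear operator h ↦ ∫ e^{i(y(x)ξ + τ(x)ξ²)} h(ξ)
dξ. By TT*, its L² → L^{2q} bound follows from the kernel ∫ e^{i(aξ + bξ²)} dξ over the annulus,
with a = y(x) - y(x') and b = τ(x) - τ(x'). The hypotheses on γ enter only here: two points at
distance d satisfy d ≲ |a| + |b|^α + ℓ^{-m}, so one of the three terms dominates. If it is ℓ^{-m},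
the trivial bound ℓ suffices. If it is |b|^α, van der Corput's |b|^{-1/2} is interpolated with ℓ. If
it is |a|, either there is no stationary point and |a|^{-1} is available, or |b| ≳ d/ℓ and van der
Corput gives (ℓ/d)^{1/2}. In every case the kernel is at most a constant times ℓ^{2σ+η} d^{-(1-η)/q}
(`exists_kernel_bound`), whose q-th power is locally integrable; the bilinear Young inequality
finishes TT* (`lintegral_enorm_rpow_le_of_kernel_le`).

The O(ℓ^{mb}) pieces, for any b above the Minkowski dimension β, cost ℓ^{mb/(2q)} after summing
2q-th powers. Hence s > σ + mβ/(2q) leaves geometric decay in n, and the annuli can be summed. The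
required σ is half the maximum of 1/2, 1 - 2α/q and 1 - m/q; the three ranges of α are three choices
of q and m. The same summation gives uniform convergence along the curves for almost every x, hence
existence of the values and measurability of the supremum. -/

/-! ### Oscillatory integrals with quadratic phase -/

/-- The oscillating factor `e^{i(yξ + tξ²)}`. -/
noncomputable def phase (t y ξ : ℝ) : ℂ :=
  Complex.exp (Complex.I * ((y * ξ + t * ξ ^ 2 : ℝ) : ℂ))

theorem norm_phase (t y ξ : ℝ) : ‖phase t y ξ‖ = 1 := by
  rw [phase, mul_comm, Complex.norm_exp_ofReal_mul_I]

theorem continuous_phase : Continuous fun z : ℝ × ℝ × ℝ => phase z.1 z.2.1 z.2.2 := by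
  unfold phase
  fun_prop

theorem continuous_phase_right (t y : ℝ) : Continuous (phase t y) := by
  unfold phase
  fun_prop

theorem phase_mul_conj (t t' y y' ξ : ℝ) :
    phase t y ξ * (starRingEnd ℂ) (phase t' y' ξ) = phase (t - t') (y - y') ξ := by
  unfold phase
  rw [← Complex.exp_conj, ← Complex.exp_add]
  congr 1
  simp only [map_mul, Complex.conj_I, Complex.conj_ofReal]
  push_cast
  ring

theorem norm_integral_phase_le_length (b a u v : ℝ) :
    ‖∫ ξ in u..v, phase b a ξ‖ ≤ |v - u| := by
  simpa using intervalIntegral.norm_integral_le_of_norm_le_const (a := u) (b := v) (C := 1)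
    (f := phase b a) (fun ξ _ => (norm_phase b a ξ).le)

/-- First derivative test for the quadratic phase. -/
theorem norm_integral_phase_le_of_le_deriv {b a u v μ : ℝ} (huv : u ≤ v) (hμ : 0 < μ)
    (h : ∀ ξ ∈ Set.Icc u v, μ ≤ |a + 2 * b * ξ|) :
    ‖∫ ξ in u..v, phase b a ξ‖ ≤ 4 / μ := by
  have hne : ∀ ξ ∈ Set.Icc u v, a + 2 * b * ξ ≠ 0 := fun ξ hξ h0 => by
    have := h ξ hξ
    rw [h0, abs_zero] at this
    linarith
  have huIcc : Set.uIcc u v = Set.Icc u v := Set.uIcc_of_le huv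
  -- ε is the sign of b: with it, 2|b|/(a + 2bξ)² has the primitive -ε/(a + 2bξ), so its integral is
  -- read off at the endpoints.
  obtain ⟨ε, hε, hb⟩ : ∃ ε : ℝ, |ε| = 1 ∧ |b| = ε * b := by
    rcases le_total 0 b with hb | hb
    · exact ⟨1, by simp, by rw [abs_of_nonneg hb, one_mul]⟩
    · exact ⟨-1, by simp, by rw [abs_of_nonpos hb]; ring⟩
  have hlin : ∀ ξ : ℝ, HasDerivAt (fun ξ : ℝ => a + 2 * b * ξ) (2 * b) ξ := fun ξ => by
    simpa using ((hasDerivAt_id ξ).const_mul (2 * b)).const_add a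
  have hcont : ContinuousOn (fun ξ : ℝ => (a + 2 * b * ξ) ^ 2) (Set.uIcc u v) :=
    Continuous.continuousOn (by fun_prop)
  have hne2 : ∀ ξ ∈ Set.uIcc u v, (a + 2 * b * ξ) ^ 2 ≠ 0 := fun ξ hξ =>
    pow_ne_zero 2 (hne ξ (huIcc ▸ hξ))
  have hI1 : IntervalIntegrable (fun ξ : ℝ => 2 * |b| / (a + 2 * b * ξ) ^ 2) volume u v :=
    (continuousOn_const.div hcont hne2).intervalIntegrable
  have hinv : ∀ ξ ∈ Set.Icc u v, |(a + 2 * b * ξ)⁻¹| ≤ 1 / μ := fun ξ hξ => by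
    rw [abs_inv, one_div]
    exact inv_anti₀ hμ (h ξ hξ)
  have hreal : ∫ ξ in u..v, 2 * |b| / (a + 2 * b * ξ) ^ 2 ≤ 2 / μ := by
    have hd : ∀ ξ ∈ Set.uIcc u v, HasDerivAt (fun ξ : ℝ => -ε * (a + 2 * b * ξ)⁻¹)
        (2 * |b| / (a + 2 * b * ξ) ^ 2) ξ := fun ξ hξ => by
      have := ((hlin ξ).inv (hne ξ (huIcc ▸ hξ))).const_mul (-ε)
      refine this.congr_deriv ?_
      rw [hb]
      ring
    rw [intervalIntegral.integral_eq_sub_of_hasDerivAt hd hI1]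
    have h1 := hinv u ⟨le_rfl, huv⟩
    have h2 := hinv v ⟨huv, le_rfl⟩
    calc _ ≤ |-ε * (a + 2 * b * v)⁻¹ - -ε * (a + 2 * b * u)⁻¹| := le_abs_self _
      _ ≤ |-ε * (a + 2 * b * v)⁻¹| + |-ε * (a + 2 * b * u)⁻¹| := abs_sub _ _
      _ ≤ 1 / μ + 1 / μ := by
        rw [abs_mul, abs_mul, abs_neg, hε, one_mul, one_mul]
        exact add_le_add h2 h1
      _ = 2 / μ := by ring
  have hneC : ∀ ξ ∈ Set.uIcc u v, ((a + 2 * b * ξ : ℝ) : ℂ) ≠ 0 := fun ξ hξ =>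
    Complex.ofReal_ne_zero.2 (hne ξ (huIcc ▸ hξ))
  have hphase : ∀ ξ : ℝ, HasDerivAt (phase b a)
      (phase b a ξ * (Complex.I * ((a + 2 * b * ξ : ℝ) : ℂ))) ξ := fun ξ => by
    have h1 : HasDerivAt (fun ξ : ℝ => a * ξ + b * ξ ^ 2) (a + 2 * b * ξ) ξ := by
      have := ((hasDerivAt_id ξ).const_mul a).add (((hasDerivAt_id ξ).pow 2).const_mul b)
      refine this.congr_deriv ?_
      simp only [id_eq]
      ring
    exact (h1.ofReal_comp.const_mul Complex.I).cexp
  -- Integration by parts, written as the derivative of e^{iφ}/(iφ'): the integrand plus an error of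
  -- size |φ''|/φ'². The endpoints contribute 1/μ each and the error 2/μ.
  have hd : ∀ ξ ∈ Set.uIcc u v,
      HasDerivAt (fun ξ : ℝ => phase b a ξ * (((a + 2 * b * ξ : ℝ) : ℂ)⁻¹ * -Complex.I))
        (phase b a ξ - phase b a ξ * (-Complex.I * ((2 * b / (a + 2 * b * ξ) ^ 2 : ℝ) : ℂ))) ξ :=
    fun ξ hξ => by
      have := (hphase ξ).mul (((hlin ξ).ofReal_comp.inv (hneC ξ hξ)).mul_const (-Complex.I))
      refine this.congr_deriv ?_
      have h0 := hneC ξ hξ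
      rw [Pi.inv_apply]
      push_cast at h0 ⊢
      field_simp
      ring_nf
      rw [Complex.I_sq]
      ring
  have hI2 : IntervalIntegrable
      (fun ξ => phase b a ξ * (-Complex.I * ((2 * b / (a + 2 * b * ξ) ^ 2 : ℝ) : ℂ)))
      volume u v :=
    ((continuous_phase_right b a).continuousOn.mul (continuousOn_const.mul
      (Complex.continuous_ofReal.comp_continuousOn
        (continuousOn_const.div hcont hne2)))).intervalIntegrable
  have hI0 : IntervalIntegrable (phase b a) volume u v :=
    (continuous_phase_right b a).intervalIntegrable u v
  have hFTC := intervalIntegral.integral_eq_sub_of_hasDerivAt hd (hI0.sub hI2)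
  rw [intervalIntegral.integral_sub hI0 hI2, sub_eq_iff_eq_add] at hFTC
  have hbd : ∀ ξ ∈ Set.Icc u v,
      ‖phase b a ξ * (((a + 2 * b * ξ : ℝ) : ℂ)⁻¹ * -Complex.I)‖ ≤ 1 / μ := fun ξ hξ => by
    rw [norm_mul, norm_mul, norm_phase, norm_neg, Complex.norm_I, one_mul, mul_one, norm_inv,
      Complex.norm_real, Real.norm_eq_abs, ← abs_inv]
    exact hinv ξ hξ
  have herr : ‖∫ ξ in u..v,
      phase b a ξ * (-Complex.I * ((2 * b / (a + 2 * b * ξ) ^ 2 : ℝ) : ℂ))‖ ≤ 2 / μ := by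
    refine (intervalIntegral.norm_integral_le_integral_norm huv).trans (le_trans (le_of_eq ?_) hreal)
    refine intervalIntegral.integral_congr fun ξ _ => ?_
    simp only [norm_mul, norm_phase, norm_neg, Complex.norm_I, one_mul, Complex.norm_real,
      Real.norm_eq_abs, abs_div, abs_mul, abs_pow, sq_abs, abs_two]
  rw [hFTC]
  calc _ ≤ 1 / μ + 1 / μ + 2 / μ :=
        (norm_add_le _ _).trans (add_le_add ((norm_sub_le _ _).trans
          (add_le_add (hbd v ⟨huv, le_rfl⟩) (hbd u ⟨le_rfl, huv⟩))) herr)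
    _ = 4 / μ := by ring

/-- Second derivative test for the quadratic phase. -/
theorem norm_integral_phase_le_rpow {b : ℝ} (a : ℝ) {u v : ℝ} (huv : u ≤ v) (hb : b ≠ 0) :
    ‖∫ ξ in u..v, phase b a ξ‖ ≤ 6 * |b| ^ (-(1 / 2) : ℝ) := by
  have hb0 : 0 < |b| := abs_pos.2 hb
  -- At this distance from the stationary point c the first derivative test and the trivial length
  -- bound both give 2ρ.
  set ρ : ℝ := |b| ^ (-(1 / 2) : ℝ) with hρ
  have hρ0 : 0 < ρ := Real.rpow_pos_of_pos hb0 _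
  have hbρ : |b| * ρ = ρ⁻¹ := by
    rw [hρ, ← Real.rpow_neg hb0.le, ← Real.rpow_one_add' hb0.le (by norm_num)]
    norm_num
  set c : ℝ := -a / (2 * b) with hc
  have hder : ∀ ξ, |a + 2 * b * ξ| = 2 * |b| * |ξ - c| := fun ξ => by
    rw [← abs_two, ← abs_mul, ← abs_mul]
    congr 1
    rw [hc]
    field_simp
    ring
  have hout : ∀ u' v' : ℝ, u' ≤ v' → (∀ ξ ∈ Set.Icc u' v', ρ ≤ |ξ - c|) →
      ‖∫ ξ in u'..v', phase b a ξ‖ ≤ 2 * ρ := fun u' v' h' hξ => by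
    have h1 : (4 : ℝ) / (2 * ρ⁻¹) = 2 * ρ := by field_simp; norm_num
    rw [← h1]
    refine norm_integral_phase_le_of_le_deriv h' (by positivity) fun ξ hξ' => ?_
    rw [hder, ← hbρ, ← mul_assoc]
    exact mul_le_mul_of_nonneg_left (hξ ξ hξ') (by positivity)
  -- The points c ∓ ρ clamped to [u, v]; a piece that would lie outside the interval degenerates to
  -- a point.
  set u₁ := max u (min v (c - ρ)) with hu₁
  set u₂ := max u₁ (min v (c + ρ)) with hu₂
  have huu₁ : u ≤ u₁ := le_max_left _ _
  have hu₁₂ : u₁ ≤ u₂ := le_max_left _ _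
  have hu₁v : u₁ ≤ v := max_le huv (min_le_left _ _)
  have hu₂v : u₂ ≤ v := max_le hu₁v (min_le_left _ _)
  have hI : ∀ x y, IntervalIntegrable (phase b a) volume x y := fun x y =>
    (continuous_phase_right b a).intervalIntegrable x y
  have e1 : ‖∫ ξ in u..u₁, phase b a ξ‖ ≤ 2 * ρ := by
    rcases eq_or_lt_of_le huu₁ with h | h
    · rw [← h, intervalIntegral.integral_same, norm_zero]
      positivity
    · refine hout u u₁ huu₁ fun ξ hξ => ?_
      have : u₁ ≤ c - ρ := by grind
      rw [abs_sub_comm]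
      exact le_trans (by linarith [hξ.2]) (le_abs_self _)
  have e2 : ‖∫ ξ in u₁..u₂, phase b a ξ‖ ≤ 2 * ρ := by
    refine (norm_integral_phase_le_length _ _ _ _).trans ?_
    rw [abs_of_nonneg (by linarith)]
    grind
  have e3 : ‖∫ ξ in u₂..v, phase b a ξ‖ ≤ 2 * ρ := by
    rcases eq_or_lt_of_le hu₂v with h | h
    · rw [← h, intervalIntegral.integral_same, norm_zero]
      positivity
    · refine hout u₂ v hu₂v fun ξ hξ => ?_
      have : c + ρ ≤ u₂ := by grind
      exact le_trans (by linarith [hξ.1]) (le_abs_self _)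
  rw [← intervalIntegral.integral_add_adjacent_intervals (hI u u₁) (hI u₁ v),
    ← intervalIntegral.integral_add_adjacent_intervals (hI u₁ u₂) (hI u₂ v)]
  calc _ ≤ 2 * ρ + (2 * ρ + 2 * ρ) :=
        (norm_add_le _ _).trans (add_le_add e1 ((norm_add_le _ _).trans (add_le_add e2 e3)))
    _ = 6 * ρ := by ring

/-! ### The TT* method -/

section DualityMethod

variable {X Y : Type*} [MeasurableSpace X] [MeasurableSpace Y]

/-- A bilinear form of Young's inequality. -/
theorem lintegral_kernel_mul_mul_le (μ : Measure X) [SFinite μ] {J : X → X → ℝ≥0∞}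
    (hJ : Measurable (Function.uncurry J)) {q : ℝ} (hq : 1 ≤ q) {A : ℝ≥0∞}
    (hl : ∀ x, ∫⁻ x', J x x' ^ q ∂μ ≤ A) (hr : ∀ x', ∫⁻ x, J x x' ^ q ∂μ ≤ A)
    {W : X → ℝ≥0∞} (hW : Measurable W) :
    ∫⁻ z, J z.1 z.2 * (W z.1 ^ (1 - 1 / (2 * q)) * W z.2 ^ (1 - 1 / (2 * q))) ∂(μ.prod μ) ≤
      A ^ (1 / q) * (∫⁻ x, W x ∂μ) ^ (2 - 1 / q) := by
  have hq0 : 0 < q := by linarith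
  set a : ℝ := 1 / (2 * q) with ha
  have ha0 : 0 ≤ a := by positivity
  have ha1 : 0 ≤ 1 - 2 * a := by
    have : 2 * a = 1 / q := by rw [ha]; field_simp
    rw [this, sub_nonneg, div_le_one hq0]
    exact hq
  have haq : 1 / q = 2 * a := by rw [ha]; field_simp
  set Z := ∫⁻ x, W x ∂μ with hZ
  have hJ' : Measurable fun z : X × X => J z.1 z.2 := hJ
  have hW1 : Measurable fun z : X × X => W z.1 := hW.comp measurable_fst
  have hW2 : Measurable fun z : X × X => W z.2 := hW.comp measurable_snd
  -- Hölder with weights a, a, 1 - 2a. Since 2aq = 1, the first two factors together restore J to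
  -- the first power, and W(x) gets the exponent a + (1 - 2a) = 1 - a, likewise W(x').
  let f : Fin 3 → X × X → ℝ≥0∞ :=
    ![fun z => J z.1 z.2 ^ q * W z.1, fun z => J z.1 z.2 ^ q * W z.2, fun z => W z.1 * W z.2]
  have key := ENNReal.lintegral_prod_norm_pow_le (μ := μ.prod μ) (Finset.univ : Finset (Fin 3))
    (f := f) (p := ![a, a, 1 - 2 * a])
    (by
      intro i _
      fin_cases i
      · exact ((hJ'.pow_const q).mul hW1).aemeasurable
      · exact ((hJ'.pow_const q).mul hW2).aemeasurable
      · exact (hW1.mul hW2).aemeasurable)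
    (by simp [Fin.sum_univ_three]; ring)
    (by
      intro i _
      fin_cases i
      · exact ha0
      · exact ha0
      · exact ha1)
  simp only [Fin.prod_univ_three] at key
  simp only [f, Matrix.cons_val_zero, Matrix.cons_val_one, Matrix.cons_val_two,
    Matrix.head_cons, Matrix.tail_cons] at key
  have e1 : ∫⁻ z, J z.1 z.2 ^ q * W z.1 ∂(μ.prod μ) ≤ A * Z := by
    rw [lintegral_prod (fun z => J z.1 z.2 ^ q * W z.1) ((hJ'.pow_const q).mul hW1).aemeasurable]
    calc _ = ∫⁻ x, (∫⁻ x', J x x' ^ q ∂μ) * W x ∂μ := by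
          refine lintegral_congr fun x => ?_
          have hx : Measurable fun x' => J x x' := hJ'.comp measurable_prodMk_left
          exact lintegral_mul_const (W x) (hx.pow_const q)
      _ ≤ ∫⁻ x, A * W x ∂μ := lintegral_mono fun x => mul_le_mul_left (hl x) _
      _ = A * Z := lintegral_const_mul _ hW
  have e2 : ∫⁻ z, J z.1 z.2 ^ q * W z.2 ∂(μ.prod μ) ≤ A * Z := by
    rw [lintegral_prod_symm (fun z => J z.1 z.2 ^ q * W z.2) ((hJ'.pow_const q).mul hW2).aemeasurable]
    calc _ = ∫⁻ x', (∫⁻ x, J x x' ^ q ∂μ) * W x' ∂μ := by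
          refine lintegral_congr fun x' => ?_
          have hx' : Measurable fun x => J x x' := hJ'.comp measurable_prodMk_right
          exact lintegral_mul_const (W x') (hx'.pow_const q)
      _ ≤ ∫⁻ x, A * W x ∂μ := lintegral_mono fun x => mul_le_mul_left (hr x) _
      _ = A * Z := lintegral_const_mul _ hW
  have e3 : ∫⁻ z, W z.1 * W z.2 ∂(μ.prod μ) = Z * Z :=
    lintegral_prod_mul hW.aemeasurable hW.aemeasurable
  calc _ = ∫⁻ z, (J z.1 z.2 ^ q * W z.1) ^ a * (J z.1 z.2 ^ q * W z.2) ^ a *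
        (W z.1 * W z.2) ^ (1 - 2 * a) ∂(μ.prod μ) := by
        refine lintegral_congr fun z => ?_
        rw [ENNReal.mul_rpow_of_nonneg _ _ ha0, ENNReal.mul_rpow_of_nonneg _ _ ha0,
          ENNReal.mul_rpow_of_nonneg _ _ ha1]
        have hJJ : (J z.1 z.2 ^ q) ^ a * (J z.1 z.2 ^ q) ^ a = J z.1 z.2 := by
          rw [← ENNReal.rpow_add_of_nonneg _ _ ha0 ha0, ← ENNReal.rpow_mul]
          have : q * (a + a) = 1 := by rw [ha]; field_simp; norm_num
          rw [this, ENNReal.rpow_one]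
        have hWW : ∀ w : ℝ≥0∞, w ^ a * w ^ (1 - 2 * a) = w ^ (1 - a) := fun w => by
          rw [← ENNReal.rpow_add_of_nonneg _ _ ha0 ha1]
          ring_nf
        rw [← hWW, ← hWW]
        nth_rewrite 1 [← hJJ]
        ring
    _ ≤ _ := key
    _ ≤ (A * Z) ^ a * (A * Z) ^ a * (Z * Z) ^ (1 - 2 * a) := by
        rw [e3]
        gcongr
    _ = A ^ (1 / q) * Z ^ (2 - 1 / q) := by
        rw [ENNReal.mul_rpow_of_nonneg _ _ ha0, ENNReal.mul_rpow_of_nonneg _ _ ha1]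
        have h1 : (2 - 1 / q : ℝ) = a + a + (1 - 2 * a) + (1 - 2 * a) := by rw [haq]; ring
        rw [h1, haq, ENNReal.rpow_add_of_nonneg _ _ (by positivity) ha1,
          ENNReal.rpow_add_of_nonneg _ _ (by positivity) ha1,
          ENNReal.rpow_add_of_nonneg _ _ ha0 ha0, two_mul,
          ENNReal.rpow_add_of_nonneg _ _ ha0 ha0]
        ring

theorem enorm_integral_ofReal_of_nonneg {μ : Measure X} {u : X → ℝ} (hu : Integrable u μ)
    (h0 : ∀ x, 0 ≤ u x) :
    ‖∫ x, ((u x : ℝ) : ℂ) ∂μ‖ₑ = ∫⁻ x, ENNReal.ofReal (u x) ∂μ := by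
  rw [integral_complex_ofReal, ← ofReal_integral_eq_lintegral_ofReal hu (ae_of_all _ h0), ← ofReal_norm,
    Complex.norm_real, Real.norm_of_nonneg (integral_nonneg h0)]

theorem integrable_of_norm_le {μ : Measure X} [IsFiniteMeasure μ] {u : X → ℂ}
    (hu : Measurable u) {D : ℝ} (h : ∀ x, ‖u x‖ ≤ D) : Integrable u μ :=
  Integrable.of_bound hu.aestronglyMeasurable D (ae_of_all _ h)

/-- The `L²` norm of `∫ Φ(x, ·) g(x) dx` is controlled by the kernel of `TT*`. -/
theorem lintegral_enorm_dual_sq_le (μ : Measure X) [IsFiniteMeasure μ] (ν : Measure Y)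
    [IsFiniteMeasure ν] {Φ : X → Y → ℂ} (hΦ : Measurable (Function.uncurry Φ))
    (hΦ1 : ∀ x ξ, ‖Φ x ξ‖ ≤ 1) {J : X → X → ℝ≥0∞}
    (hK : ∀ᵐ z ∂(μ.prod μ), ‖∫ ξ, Φ z.1 ξ * (starRingEnd ℂ) (Φ z.2 ξ) ∂ν‖ₑ ≤ J z.1 z.2)
    {g : X → ℂ} (hg : Measurable g) {D : ℝ} (hD : ∀ x, ‖g x‖ ≤ D) :
    ∫⁻ ξ, ‖∫ x, Φ x ξ * g x ∂μ‖ₑ ^ (2 : ℝ) ∂ν ≤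
      ∫⁻ z, J z.1 z.2 * (‖g z.1‖ₑ * ‖g z.2‖ₑ) ∂(μ.prod μ) := by
  set S : Y → ℂ := fun ξ => ∫ x, Φ x ξ * g x ∂μ with hS
  have hΦg : Measurable fun z : Y × X => Φ z.2 z.1 * g z.2 :=
    (hΦ.comp measurable_swap).mul (hg.comp measurable_snd)
  have hΦgD : ∀ x ξ, ‖Φ x ξ * g x‖ ≤ D := fun x ξ => by
    rw [norm_mul]
    exact (mul_le_of_le_one_left (norm_nonneg _) (hΦ1 x ξ)).trans (hD x)
  have hSm : Measurable S := hΦg.stronglyMeasurable.integral_prod_right'.measurable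
  have hSb : ∀ ξ, ‖S ξ‖ ≤ D * μ.real Set.univ := fun ξ =>
    norm_integral_le_of_norm_le_const (ae_of_all _ fun x => hΦgD x ξ)
  have hSint : Integrable (fun ξ => ‖S ξ‖ ^ 2) ν := by
    refine Integrable.of_bound (hSm.norm.pow_const 2).aestronglyMeasurable
      ((D * μ.real Set.univ) ^ 2) (ae_of_all _ fun ξ => ?_)
    rw [Real.norm_of_nonneg (by positivity)]
    exact pow_le_pow_left₀ (norm_nonneg _) (hSb ξ) 2
  have e1 : ∫⁻ ξ, ‖S ξ‖ₑ ^ (2 : ℝ) ∂ν = ‖∫ ξ, S ξ * (starRingEnd ℂ) (S ξ) ∂ν‖ₑ := by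
    have : ∀ ξ, S ξ * (starRingEnd ℂ) (S ξ) = ((‖S ξ‖ ^ 2 : ℝ) : ℂ) := fun ξ => by
      rw [Complex.mul_conj']
      push_cast
      rfl
    simp_rw [this]
    rw [enorm_integral_ofReal_of_nonneg hSint fun ξ => by positivity]
    refine lintegral_congr fun ξ => ?_
    rw [ENNReal.ofReal_pow (norm_nonneg _), ofReal_norm]
    exact ENNReal.rpow_natCast _ 2
  -- The square of S is opened into a double integral, so that Fubini brings the ξ-integral inside,
  -- where it is the kernel of TT*.
  let Ψ : Y → X × X → ℂ := fun ξ z =>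
    (Φ z.1 ξ * g z.1) * (starRingEnd ℂ) (Φ z.2 ξ * g z.2)
  have hΨm : Measurable (Function.uncurry Ψ) := by
    refine Measurable.mul (hΦg.comp (measurable_fst.prodMk (measurable_fst.comp measurable_snd)))
      (Complex.continuous_conj.measurable.comp
        (hΦg.comp (measurable_fst.prodMk (measurable_snd.comp measurable_snd))))
  have hΨb : ∀ w : Y × X × X, ‖Function.uncurry Ψ w‖ ≤ D * D := fun w => by
    simp only [Function.uncurry, Ψ, norm_mul, RCLike.norm_conj]
    have h1 := hΦgD w.2.1 w.1
    have h2 := hΦgD w.2.2 w.1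
    rw [norm_mul] at h1 h2
    exact mul_le_mul h1 h2 (by positivity) ((by positivity : (0 : ℝ) ≤ _).trans h1)
  have e2 : ∀ ξ, S ξ * (starRingEnd ℂ) (S ξ) = ∫ z, Ψ ξ z ∂(μ.prod μ) := fun ξ => by
    rw [hS]
    dsimp only
    rw [← integral_conj]
    exact (integral_prod_mul (fun x => Φ x ξ * g x)
      (fun x => (starRingEnd ℂ) (Φ x ξ * g x))).symm
  rw [e1]
  simp_rw [e2]
  rw [integral_integral_swap (integrable_of_norm_le hΨm hΨb)]
  refine (enorm_integral_le_lintegral_enorm _).trans (lintegral_mono_ae ?_)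
  filter_upwards [hK] with z hz
  have : ∫ ξ, Ψ ξ z ∂ν = (∫ ξ, Φ z.1 ξ * (starRingEnd ℂ) (Φ z.2 ξ) ∂ν) *
      (g z.1 * (starRingEnd ℂ) (g z.2)) := by
    rw [← integral_mul_const]
    refine integral_congr_ae (ae_of_all _ fun ξ => ?_)
    simp only [Ψ, map_mul]
    ring
  rw [this, enorm_mul, enorm_mul, RCLike.enorm_conj]
  gcongr

/-- The `TT*` method for `h ↦ ∫ Φ(·, ξ) h(ξ) dξ` as a map from `L²` to `L^{2q}`. -/
theorem lintegral_enorm_rpow_le_of_kernel_le (μ : Measure X) [IsFiniteMeasure μ] (ν : Measure Y)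
    [IsFiniteMeasure ν] {Φ : X → Y → ℂ} (hΦ : Measurable (Function.uncurry Φ))
    (hΦ1 : ∀ x ξ, ‖Φ x ξ‖ ≤ 1) {J : X → X → ℝ≥0∞} (hJ : Measurable (Function.uncurry J))
    (hK : ∀ᵐ z ∂(μ.prod μ), ‖∫ ξ, Φ z.1 ξ * (starRingEnd ℂ) (Φ z.2 ξ) ∂ν‖ₑ ≤ J z.1 z.2)
    {q : ℝ} (hq : 1 ≤ q) {A : ℝ≥0∞}
    (hl : ∀ x, ∫⁻ x', J x x' ^ q ∂μ ≤ A) (hr : ∀ x', ∫⁻ x, J x x' ^ q ∂μ ≤ A)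
    {h : Y → ℂ} (hm : Measurable h) (hh : Integrable h ν) :
    ∫⁻ x, ‖∫ ξ, Φ x ξ * h ξ ∂ν‖ₑ ^ (2 * q) ∂μ ≤ A * (∫⁻ ξ, ‖h ξ‖ₑ ^ (2 : ℝ) ∂ν) ^ q := by
  have hq0 : 0 < q := by linarith
  set F : X → ℂ := fun x => ∫ ξ, Φ x ξ * h ξ ∂ν with hF
  have hΦh : Measurable fun z : X × Y => Φ z.1 z.2 * h z.2 := hΦ.mul (hm.comp measurable_snd)
  have hFm : Measurable F := hΦh.stronglyMeasurable.integral_prod_right'.measurable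
  set D : ℝ := ∫ ξ, ‖h ξ‖ ∂ν with hD
  have hFD : ∀ x, ‖F x‖ ≤ D := fun x => by
    refine norm_integral_le_of_norm_le hh.norm (ae_of_all _ fun ξ => ?_)
    rw [norm_mul]
    exact mul_le_of_le_one_left (norm_nonneg _) (hΦ1 x ξ)
  -- The dual function of F in L^{2q}: F g = |F|^{2q}, while |g| is the power of W that the bilinear
  -- inequality asks for.
  set g : X → ℂ := fun x => (starRingEnd ℂ) (F x) * ((‖F x‖ ^ (2 * q - 2) : ℝ) : ℂ) with hg
  have hgm : Measurable g := (Complex.continuous_conj.measurable.comp hFm).mul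
    (Complex.measurable_ofReal.comp (hFm.norm.pow_const _))
  have hgn : ∀ x, ‖g x‖ = ‖F x‖ ^ (2 * q - 1) := fun x => by
    rw [hg]
    dsimp only
    rw [norm_mul, RCLike.norm_conj, Complex.norm_real, Real.norm_of_nonneg (by positivity),
      ← Real.rpow_one_add' (norm_nonneg _) (by linarith)]
    ring_nf
  have hgD : ∀ x, ‖g x‖ ≤ D ^ (2 * q - 1) := fun x => by
    rw [hgn]
    exact Real.rpow_le_rpow (norm_nonneg _) (hFD x) (by linarith)
  set W : X → ℝ≥0∞ := fun x => ‖F x‖ₑ ^ (2 * q) with hW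
  have hWm : Measurable W := hFm.enorm.pow_const _
  set Z : ℝ≥0∞ := ∫⁻ x, W x ∂μ with hZ
  have hgW : ∀ x, ‖g x‖ₑ = W x ^ (1 - 1 / (2 * q)) := fun x => by
    rw [hW]
    dsimp only
    rw [← ENNReal.rpow_mul, ← ofReal_norm, hgn, ← ofReal_norm,
      ENNReal.ofReal_rpow_of_nonneg (norm_nonneg _) (by
        have : 2 * q * (1 - 1 / (2 * q)) = 2 * q - 1 := by field_simp
        rw [this]; linarith)]
    congr 2
    field_simp
  have hZtop : Z ≠ ∞ := by
    have : Z ≤ ∫⁻ _, ENNReal.ofReal D ^ (2 * q) ∂μ := by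
      refine lintegral_mono fun x => ENNReal.rpow_le_rpow ?_ (by positivity)
      rw [← ofReal_norm]
      exact ENNReal.ofReal_le_ofReal (hFD x)
    refine ne_top_of_le_ne_top ?_ this
    rw [lintegral_const]
    exact ENNReal.mul_ne_top (ENNReal.rpow_ne_top_of_nonneg (by positivity) ENNReal.ofReal_ne_top)
      (measure_ne_top _ _)
  have hprod : Integrable (Function.uncurry fun x ξ => (Φ x ξ * h ξ) * g x) (μ.prod ν) := by
    have h1 : Integrable (fun z : X × Y => h z.2) (μ.prod ν) := hh.comp_snd μ
    have h2 : Integrable (fun z : X × Y => (Φ z.1 z.2 * g z.1) * h z.2) (μ.prod ν) := by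
      refine h1.bdd_mul (c := D ^ (2 * q - 1))
        (hΦ.mul (hgm.comp measurable_fst)).aestronglyMeasurable (ae_of_all _ fun z => ?_)
      rw [norm_mul]
      exact (mul_le_of_le_one_left (norm_nonneg _) (hΦ1 _ _)).trans (hgD _)
    refine h2.congr (ae_of_all _ fun z => ?_)
    simp only [Function.uncurry]
    ring
  have e1 : Z = ‖∫ ξ, h ξ * ∫ x, Φ x ξ * g x ∂μ ∂ν‖ₑ := by
    have h1 : ∫ ξ, h ξ * ∫ x, Φ x ξ * g x ∂μ ∂ν = ∫ x, F x * g x ∂μ := by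
      rw [hF]
      simp_rw [← integral_mul_const, ← integral_const_mul]
      rw [integral_integral_swap hprod]
      refine integral_congr_ae (ae_of_all _ fun ξ => ?_)
      refine integral_congr_ae (ae_of_all _ fun x => ?_)
      simp only
      ring
    have h2 : ∀ x, F x * g x = ((‖F x‖ ^ (2 * q) : ℝ) : ℂ) := fun x => by
      rw [hg]
      dsimp only
      rw [← mul_assoc, Complex.mul_conj']
      norm_cast
      rw [← Real.rpow_natCast, ← Real.rpow_add' (norm_nonneg _) (by push_cast; linarith)]
      push_cast
      ring_nf
    have h3 : Integrable (fun x => ‖F x‖ ^ (2 * q)) μ := by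
      refine Integrable.of_bound (hFm.norm.pow_const _).aestronglyMeasurable (D ^ (2 * q))
        (ae_of_all _ fun x => ?_)
      rw [Real.norm_of_nonneg (by positivity)]
      exact Real.rpow_le_rpow (norm_nonneg _) (hFD x) (by positivity)
    rw [h1]
    simp_rw [h2]
    rw [enorm_integral_ofReal_of_nonneg h3 fun x => by positivity]
    refine lintegral_congr fun x => ?_
    rw [← ENNReal.ofReal_rpow_of_nonneg (norm_nonneg _) (by positivity), ofReal_norm]
  set H : ℝ≥0∞ := ∫⁻ ξ, ‖h ξ‖ₑ ^ (2 : ℝ) ∂ν with hH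
  have hSm : Measurable fun ξ => ∫ x, Φ x ξ * g x ∂μ := by
    have : Measurable fun z : Y × X => Φ z.2 z.1 * g z.2 :=
      (hΦ.comp measurable_swap).mul (hgm.comp measurable_snd)
    exact this.stronglyMeasurable.integral_prod_right'.measurable
  have e2 : Z ≤ H ^ (1 / 2 : ℝ) *
      (∫⁻ ξ, ‖∫ x, Φ x ξ * g x ∂μ‖ₑ ^ (2 : ℝ) ∂ν) ^ (1 / 2 : ℝ) := by
    rw [e1]
    refine (enorm_integral_le_lintegral_enorm _).trans ?_
    simp_rw [enorm_mul]
    exact ENNReal.lintegral_mul_le_Lp_mul_Lq ν Real.HolderConjugate.two_two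
      hm.enorm.aemeasurable hSm.enorm.aemeasurable
  have e3 := lintegral_enorm_dual_sq_le μ ν hΦ hΦ1 hK hgm hgD
  simp_rw [hgW] at e3
  have e4 := e2.trans (mul_le_mul_right (ENNReal.rpow_le_rpow
    (e3.trans (lintegral_kernel_mul_mul_le μ hJ hq hl hr hWm)) (by norm_num : (0 : ℝ) ≤ 1 / 2)) _)
  rcases eq_or_ne Z 0 with hZ0 | hZ0
  · rw [hZ0]
    exact zero_le
  -- Duality bounds Z by a power of itself: Z ≤ H^{1/2} (A^{1/q} Z^{2-1/q})^{1/2}. Raised to 2q, one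
  -- factor Z survives after cancelling Z^{2q-1}, which is legitimate because 0 < Z < ∞.
  have e5 : Z ^ (2 * q) ≤ (A * H ^ q) * Z ^ (2 * q - 1) := by
    refine (ENNReal.rpow_le_rpow e4 (by positivity : 0 ≤ 2 * q)).trans (le_of_eq ?_)
    rw [ENNReal.mul_rpow_of_nonneg _ _ (by positivity), ← ENNReal.rpow_mul, ← ENNReal.rpow_mul,
      ENNReal.mul_rpow_of_nonneg _ _ (by positivity), ← ENNReal.rpow_mul, ← ENNReal.rpow_mul]
    have a1 : 1 / 2 * (2 * q) = q := by ring
    have a2 : 1 / q * q = 1 := by field_simp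
    have a3 : (2 - 1 / q) * q = 2 * q - 1 := by field_simp
    rw [a1, a2, a3, ENNReal.rpow_one]
    ring
  have e6 : Z ^ (2 * q) = Z * Z ^ (2 * q - 1) := by
    nth_rewrite 2 [← ENNReal.rpow_one Z]
    rw [← ENNReal.rpow_add _ _ hZ0 hZtop]
    ring_nf
  rw [e6] at e5
  exact (ENNReal.mul_le_mul_iff_left (ENNReal.rpow_pos (pos_iff_ne_zero.2 hZ0) hZtop).ne'
    (ENNReal.rpow_ne_top_of_nonneg (by linarith) hZtop)).1 e5

end DualityMethod

/-! ### Kernel bounds on a frequency annulus -/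

/-- The frequency annulus `ℓ < |ξ| ≤ 2ℓ`. -/
def annulus (ℓ : ℝ) : Set ℝ :=
  Set.Icc (-(2 * ℓ)) (2 * ℓ) \ Set.Icc (-ℓ) ℓ

theorem measurableSet_annulus (ℓ : ℝ) : MeasurableSet (annulus ℓ) :=
  measurableSet_Icc.diff measurableSet_Icc

theorem volume_annulus_lt_top (ℓ : ℝ) : volume (annulus ℓ) < ∞ :=
  (measure_mono Set.sdiff_subset).trans_lt measure_Icc_lt_top

theorem setIntegral_annulus {ℓ : ℝ} (hℓ : 0 ≤ ℓ) {u : ℝ → ℂ}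
    (hu : IntegrableOn u (Set.Icc (-(2 * ℓ)) (2 * ℓ))) :
    ∫ ξ in annulus ℓ, u ξ =
      (∫ ξ in Set.Icc (-(2 * ℓ)) (2 * ℓ), u ξ) - ∫ ξ in Set.Icc (-ℓ) ℓ, u ξ :=
  setIntegral_sdiff measurableSet_Icc hu (Set.Icc_subset_Icc (by linarith) (by linarith))

/-- An annulus is a difference of two symmetric intervals, so bounds over intervals carry over with
a factor 2. -/
theorem norm_setIntegral_annulus_phase_le {ℓ B : ℝ} (hℓ : 0 ≤ ℓ) (b a : ℝ)
    (h : ∀ L, 0 ≤ L → L ≤ 2 * ℓ → ‖∫ ξ in (-L)..L, phase b a ξ‖ ≤ B) :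
    ‖∫ ξ in annulus ℓ, phase b a ξ‖ ≤ 2 * B := by
  rw [setIntegral_annulus hℓ (continuous_phase_right b a).continuousOn.integrableOn_Icc,
    integral_Icc_eq_integral_Ioc, integral_Icc_eq_integral_Ioc,
    ← intervalIntegral.integral_of_le (by linarith), ← intervalIntegral.integral_of_le (by linarith)]
  have h1 := h (2 * ℓ) (by linarith) le_rfl
  have h2 := h ℓ hℓ (by linarith)
  linarith [norm_sub_le (∫ ξ in (-(2 * ℓ))..(2 * ℓ), phase b a ξ) (∫ ξ in (-ℓ)..ℓ, phase b a ξ)]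

theorem norm_kernel_le_frequency {ℓ : ℝ} (hℓ : 0 ≤ ℓ) (b a : ℝ) :
    ‖∫ ξ in annulus ℓ, phase b a ξ‖ ≤ 8 * ℓ := by
  have := norm_setIntegral_annulus_phase_le (B := 4 * ℓ) hℓ b a fun L hL hL' => by
    refine (norm_integral_phase_le_length b a _ _).trans ?_
    rw [abs_of_nonneg (by linarith)]
    linarith
  linarith

theorem norm_kernel_le_time {ℓ : ℝ} (hℓ : 0 ≤ ℓ) {b : ℝ} (hb : b ≠ 0) (a : ℝ) :
    ‖∫ ξ in annulus ℓ, phase b a ξ‖ ≤ 12 * |b| ^ (-(1 / 2) : ℝ) := by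
  have := norm_setIntegral_annulus_phase_le hℓ b a fun L hL _ =>
    norm_integral_phase_le_rpow a (by linarith : -L ≤ L) hb
  linarith

/-- For |ξ| ≤ 2ℓ the quadratic term moves the phase derivative by at most 4ℓ|b| ≤ |a|/2, so it stays
above |a|/2. -/
theorem norm_kernel_le_space {ℓ : ℝ} (hℓ : 0 ≤ ℓ) {b a : ℝ} (ha : 0 < |a|)
    (hab : 8 * ℓ * |b| ≤ |a|) :
    ‖∫ ξ in annulus ℓ, phase b a ξ‖ ≤ 16 * |a|⁻¹ := by
  have h := norm_setIntegral_annulus_phase_le (B := 8 * |a|⁻¹) hℓ b a fun L hL hL' => by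
    have h0 : (4 : ℝ) / (|a| / 2) = 8 * |a|⁻¹ := by field_simp; norm_num
    rw [← h0]
    refine norm_integral_phase_le_of_le_deriv (by linarith) (by linarith) fun ξ hξ => ?_
    have h1 : |2 * b * ξ| ≤ 4 * ℓ * |b| := by
      rw [abs_mul, abs_mul, abs_two]
      have : |ξ| ≤ 2 * ℓ := (abs_le.2 hξ).trans hL'
      nlinarith [abs_nonneg b]
    have h2 := abs_sub_abs_le_abs_sub a (-(2 * b * ξ))
    rw [sub_neg_eq_add, abs_neg] at h2
    linarith
  linarith

/-- Geometric mean of two bounds. It trades decay for powers of ℓ, to reach an exponent of d that is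
integrable. -/
theorem le_mul_rpow_mul_rpow {V M u v τ : ℝ} (hV : 0 ≤ V) (hM : 0 ≤ M) (hu : 0 ≤ u) (hv : 0 ≤ v)
    (h0 : 0 ≤ τ) (h1 : τ ≤ 1) (hVu : V ≤ M * u) (hVv : V ≤ M * v) :
    V ≤ M * (u ^ (1 - τ) * v ^ τ) := by
  calc V = V ^ (1 - τ) * V ^ τ := by
        rw [← Real.rpow_add' hV (by norm_num), sub_add_cancel, Real.rpow_one]
    _ ≤ (M * u) ^ (1 - τ) * (M * v) ^ τ := by
        have : 0 ≤ 1 - τ := by linarith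
        gcongr
    _ = M ^ (1 - τ) * M ^ τ * (u ^ (1 - τ) * v ^ τ) := by
        rw [Real.mul_rpow hM hu, Real.mul_rpow hM hv]
        ring
    _ = M * (u ^ (1 - τ) * v ^ τ) := by
        rw [← Real.rpow_add' hM (by norm_num), sub_add_cancel, Real.rpow_one]

/-- The stationary phase bounds for the kernel combine into a single power of the distance `d`,
with an exponent that makes the `q`-th power integrable. -/
theorem exists_kernel_bound {α C₁ C₂ C₃ q m σ η R : ℝ} (hα : 0 < α) (hC₁ : 1 ≤ C₁) (hC₂ : 0 < C₂)
    (hC₃ : 0 < C₃) (hq1 : 1 ≤ q) (hq2 : q ≤ 2) (hαq : 2 * α ≤ q) (hmq : m ≤ q)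
    (hσ : 1 / 2 ≤ 2 * σ) (hσα : 1 - 2 * α / q ≤ 2 * σ) (hσm : 1 - m / q ≤ 2 * σ)
    (hη0 : 0 < η) (hη1 : η < 1) (hR : 0 < R) :
    ∃ C : ℝ, 0 < C ∧ ∀ ℓ a b d V : ℝ, 1 ≤ ℓ → 0 < d → d ≤ R → 0 ≤ V →
      C₁⁻¹ * d ≤ |a| + C₂ * |b| ^ α + C₃ * ℓ ^ (-m) → V ≤ 8 * ℓ →
      (b ≠ 0 → V ≤ 12 * |b| ^ (-(1 / 2) : ℝ)) →
      (0 < |a| → 8 * ℓ * |b| ≤ |a| → V ≤ 16 * |a|⁻¹) →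
      V ≤ C * (ℓ ^ (2 * σ + η) * d ^ (-((1 - η) / q))) := by
  have hq0 : 0 < q := by linarith
  -- κ is the target exponent, with κq = 1 - η < 1. κ₀ is what the space-dominated case yields; it
  -- is at most κ because q ≤ 2, and the excess is absorbed by d ≤ R.
  set κ : ℝ := (1 - η) / q with hκ
  set κ₀ : ℝ := (1 - η) / 2 with hκ₀
  have hκ0 : 0 < κ := div_pos (by linarith) hq0
  have hκ₀0 : 0 < κ₀ := by rw [hκ₀]; linarith
  have hκκ : κ₀ ≤ κ := div_le_div_of_nonneg_left (by linarith) hq0 hq2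
  have hC₁0 : 0 < C₁ := by linarith
  -- The factors 3 ensure that, if neither the time nor the parameter term reaches d/(3C₁), then |a|
  -- does.
  set c := 3 * C₁ * C₂ with hc
  set c' := 3 * C₁ * C₃ with hc'
  have hc0 : 0 < c := by positivity
  have hc'0 : 0 < c' := by positivity
  have hκR : 0 < R ^ (κ - κ₀) := Real.rpow_pos_of_pos hR _
  refine ⟨8 * c' ^ κ + 12 * c ^ κ + 48 * C₁ * R ^ (κ - κ₀) + 12 * (24 * C₁) ^ κ₀ * R ^ (κ - κ₀),
    by positivity, ?_⟩
  intro ℓ a b d V hℓ hd hdR hV hdist hVℓ hVb hVa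
  have hℓ0 : 0 < ℓ := by linarith
  have hP : 0 < ℓ ^ (2 * σ + η) * d ^ (-κ) := by positivity
  have hdκ : 0 < d ^ (-κ) := Real.rpow_pos_of_pos hd _
  have hrw : ∀ k : ℝ, 0 < k → (d / k) ^ (-κ) = k ^ κ * d ^ (-κ) := fun k hk => by
    rw [Real.div_rpow hd.le hk.le, Real.rpow_neg hk.le, div_inv_eq_mul, mul_comm]
  -- Parameter-dominated: multiply the trivial bound 8ℓ by (c'ℓ^{-m}/d)^κ ≥ 1. The power of ℓ is 1 -
  -- mκ ≤ 1 - m/q + η, as m ≤ q.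
  rcases le_or_gt d (c' * ℓ ^ (-m)) with hcase | hcase
  · have h1 : 1 ≤ c' ^ κ * ℓ ^ (-(m * κ)) * d ^ (-κ) := by
      have : (c' * ℓ ^ (-m)) ^ (-κ) ≤ d ^ (-κ) :=
        Real.rpow_le_rpow_of_nonpos hd hcase (by linarith)
      have e1 : c' ^ κ * ℓ ^ (-(m * κ)) * (c' * ℓ ^ (-m)) ^ (-κ) = 1 := by
        have : c' ^ κ * ℓ ^ (-(m * κ)) = (c' * ℓ ^ (-m)) ^ κ := by
          rw [Real.mul_rpow hc'0.le (by positivity), ← Real.rpow_mul hℓ0.le]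
          ring_nf
        rw [this, ← Real.rpow_add (by positivity), add_neg_cancel, Real.rpow_zero]
      rw [← e1]
      gcongr
    have h2 : V ≤ 8 * c' ^ κ * (ℓ ^ (1 - m * κ) * d ^ (-κ)) := by
      calc V ≤ 8 * ℓ * 1 := by linarith
        _ ≤ 8 * ℓ * (c' ^ κ * ℓ ^ (-(m * κ)) * d ^ (-κ)) := by gcongr
        _ = 8 * c' ^ κ * (ℓ ^ (1 - m * κ) * d ^ (-κ)) := by
          rw [sub_eq_add_neg, Real.rpow_add hℓ0, Real.rpow_one]
          ring
    have h3 : 1 - m * κ ≤ 2 * σ + η := by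
      have : m * κ = m / q - m / q * η := by rw [hκ]; ring
      have h4 := mul_le_of_le_one_left hη0.le ((div_le_one hq0).2 hmq)
      linarith
    calc V ≤ 8 * c' ^ κ * (ℓ ^ (1 - m * κ) * d ^ (-κ)) := h2
      _ ≤ 8 * c' ^ κ * (ℓ ^ (2 * σ + η) * d ^ (-κ)) := by gcongr
      _ ≤ _ := by
        refine mul_le_mul_of_nonneg_right ?_ hP.le
        have : 0 < c ^ κ := by positivity
        have : 0 < (24 * C₁) ^ κ₀ := by positivity
        have : 0 < 48 * C₁ * R ^ (κ - κ₀) := by positivity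
        have : 0 < 12 * (24 * C₁) ^ κ₀ * R ^ (κ - κ₀) := by positivity
        linarith
  -- Time-dominated: interpolating with weight 2ακ turns |b|^{-1/2} into (|b|^α)^{-κ}, comparable to
  -- d^{-κ} at worst.
  rcases le_or_gt d (c * |b| ^ α) with hcase2 | hcase2
  · have hb : b ≠ 0 := by
      rintro rfl
      rw [abs_zero, Real.zero_rpow hα.ne', mul_zero] at hcase2
      linarith
    have hb0 : 0 < |b| := abs_pos.2 hb
    have hτ1 : 2 * α * κ ≤ 1 := by
      have : 2 * α * κ = 2 * α / q * (1 - η) := by rw [hκ]; ring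
      rw [this]
      exact mul_le_one₀ ((div_le_one hq0).2 hαq) (by linarith) (by linarith)
    have h1 := le_mul_rpow_mul_rpow (τ := 2 * α * κ) hV (by norm_num : (0 : ℝ) ≤ 12) hℓ0.le
      (by positivity) (by positivity) hτ1 (by linarith) (hVb hb)
    have h2 : (|b| ^ (-(1 / 2) : ℝ)) ^ (2 * α * κ) ≤ c ^ κ * d ^ (-κ) := by
      have e1 : (|b| ^ (-(1 / 2) : ℝ)) ^ (2 * α * κ) = (|b| ^ α) ^ (-κ) := by
        rw [← Real.rpow_mul hb0.le, ← Real.rpow_mul hb0.le]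
        ring_nf
      rw [e1, ← hrw c hc0]
      refine Real.rpow_le_rpow_of_nonpos (by positivity) ?_ (by linarith)
      rw [div_le_iff₀ hc0]
      linarith
    have h3 : 1 - 2 * α * κ ≤ 2 * σ + η := by
      have : 2 * α * κ = 2 * α / q - 2 * α / q * η := by rw [hκ]; ring
      have h4 := mul_le_of_le_one_left hη0.le ((div_le_one hq0).2 hαq)
      linarith
    calc V ≤ 12 * (ℓ ^ (1 - 2 * α * κ) * (|b| ^ (-(1 / 2) : ℝ)) ^ (2 * α * κ)) := h1
      _ ≤ 12 * (ℓ ^ (2 * σ + η) * (c ^ κ * d ^ (-κ))) := by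
        gcongr
      _ = 12 * c ^ κ * (ℓ ^ (2 * σ + η) * d ^ (-κ)) := by ring
      _ ≤ _ := by
        refine mul_le_mul_of_nonneg_right ?_ hP.le
        have : 0 < c' ^ κ := by positivity
        have : 0 < 48 * C₁ * R ^ (κ - κ₀) := by positivity
        have : 0 < 12 * (24 * C₁) ^ κ₀ * R ^ (κ - κ₀) := by positivity
        linarith
  have had : d / (3 * C₁) ≤ |a| := by
    rw [div_le_iff₀ (by positivity)]
    have h1 : C₁ * (C₁⁻¹ * d) ≤ C₁ * (|a| + C₂ * |b| ^ α + C₃ * ℓ ^ (-m)) :=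
      mul_le_mul_of_nonneg_left hdist hC₁0.le
    rw [mul_inv_cancel_left₀ hC₁0.ne'] at h1
    rw [hc'] at hcase
    rw [hc] at hcase2
    linarith
  have ha0 : 0 < |a| := lt_of_lt_of_le (by positivity) had
  have hκ₀2 : 2 * κ₀ = 1 - η := by rw [hκ₀]; ring
  have hdd : d ^ (-κ₀) ≤ R ^ (κ - κ₀) * d ^ (-κ) := by
    have : d ^ (-κ₀) = d ^ (κ - κ₀) * d ^ (-κ) := by
      rw [← Real.rpow_add hd]
      ring_nf
    rw [this]
    have : 0 ≤ κ - κ₀ := by linarith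
    gcongr
  have hexp : 1 - κ₀ ≤ 2 * σ + η := by linarith
  -- Space-dominated: either the phase has no stationary point, or |b| > |a|/(8ℓ) ≳ d/ℓ. Both lead
  -- to ℓ^{1-κ₀} d^{-κ₀}, and 1 - κ₀ = (1 + η)/2 is why 2σ ≥ 1/2 is needed.
  rcases le_or_gt (8 * ℓ * |b|) |a| with hab | hab
  · have hV1 : V ≤ 48 * C₁ * d⁻¹ := by
      refine (hVa ha0 hab).trans ?_
      calc 16 * |a|⁻¹ ≤ 16 * (d / (3 * C₁))⁻¹ := by gcongr
        _ = 48 * C₁ * d⁻¹ := by rw [inv_div]; field_simp; norm_num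
    have hVℓ' : V ≤ 48 * C₁ * ℓ :=
      hVℓ.trans (mul_le_mul_of_nonneg_right (by linarith) hℓ0.le)
    have h1 := le_mul_rpow_mul_rpow (τ := κ₀) hV (by positivity : (0 : ℝ) ≤ 48 * C₁) hℓ0.le
      (by positivity) hκ₀0.le (by linarith) hVℓ' hV1
    rw [Real.inv_rpow hd.le, ← Real.rpow_neg hd.le] at h1
    calc V ≤ 48 * C₁ * (ℓ ^ (1 - κ₀) * d ^ (-κ₀)) := h1
      _ ≤ 48 * C₁ * (ℓ ^ (2 * σ + η) * (R ^ (κ - κ₀) * d ^ (-κ))) := by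
        gcongr
      _ = 48 * C₁ * R ^ (κ - κ₀) * (ℓ ^ (2 * σ + η) * d ^ (-κ)) := by ring
      _ ≤ _ := by
        refine mul_le_mul_of_nonneg_right ?_ hP.le
        have : 0 < c' ^ κ := by positivity
        have : 0 < c ^ κ := by positivity
        have : 0 < 12 * (24 * C₁) ^ κ₀ * R ^ (κ - κ₀) := by positivity
        linarith
  · have hbd : d / (24 * C₁ * ℓ) ≤ |b| := by
      rw [div_le_iff₀ (by positivity)]
      rw [div_le_iff₀ (by positivity)] at had
      have : 8 * ℓ * |b| * (3 * C₁) = |b| * (24 * C₁ * ℓ) := by ring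
      have h3 : |a| * (3 * C₁) ≤ 8 * ℓ * |b| * (3 * C₁) :=
        mul_le_mul_of_nonneg_right hab.le (by positivity)
      linarith
    have hb0 : 0 < |b| := lt_of_lt_of_le (by positivity) hbd
    have h1 := le_mul_rpow_mul_rpow (τ := 2 * κ₀) hV (by norm_num : (0 : ℝ) ≤ 12) hℓ0.le
      (by positivity) (by positivity) (by linarith) (by linarith) (hVb (abs_pos.1 hb0))
    have h2 : (|b| ^ (-(1 / 2) : ℝ)) ^ (2 * κ₀) ≤ (24 * C₁) ^ κ₀ * ℓ ^ κ₀ * d ^ (-κ₀) := by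
      rw [← Real.rpow_mul hb0.le]
      have e1 : -(1 / 2) * (2 * κ₀) = -κ₀ := by ring
      rw [e1]
      refine (Real.rpow_le_rpow_of_nonpos (by positivity) hbd (by linarith)).trans (le_of_eq ?_)
      rw [Real.div_rpow hd.le (by positivity), Real.rpow_neg (by positivity : 0 ≤ 24 * C₁ * ℓ),
        div_inv_eq_mul, Real.mul_rpow (by positivity) hℓ0.le, mul_comm]
    calc V ≤ 12 * (ℓ ^ (1 - 2 * κ₀) * (|b| ^ (-(1 / 2) : ℝ)) ^ (2 * κ₀)) := h1
      _ ≤ 12 * (ℓ ^ (1 - 2 * κ₀) * ((24 * C₁) ^ κ₀ * ℓ ^ κ₀ * d ^ (-κ₀))) := by gcongr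
      _ = 12 * (24 * C₁) ^ κ₀ * (ℓ ^ (1 - κ₀) * d ^ (-κ₀)) := by
        have : ℓ ^ (1 - κ₀) = ℓ ^ (1 - 2 * κ₀) * ℓ ^ κ₀ := by
          rw [← Real.rpow_add hℓ0]
          ring_nf
        rw [this]
        ring
      _ ≤ 12 * (24 * C₁) ^ κ₀ * (ℓ ^ (2 * σ + η) * (R ^ (κ - κ₀) * d ^ (-κ))) := by
        gcongr
      _ = 12 * (24 * C₁) ^ κ₀ * R ^ (κ - κ₀) * (ℓ ^ (2 * σ + η) * d ^ (-κ)) := by ring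
      _ ≤ _ := by
        refine mul_le_mul_of_nonneg_right ?_ hP.le
        have : 0 < c' ^ κ := by positivity
        have : 0 < c ^ κ := by positivity
        have : 0 < 48 * C₁ * R ^ (κ - κ₀) := by positivity
        linarith

/-! ### Curve families and measurable selection -/

namespace IsCurveFamily

variable {Θ : Set ℝ} {α C₁ C₂ C₃ : ℝ} {γ : ℝ → ℝ → ℝ → ℝ}

/-- Compare at common (t, θ), where the bi-Lipschitz bound applies, then move the second point in
time and in parameter. This is the trichotomy behind the kernel bound. -/
theorem inv_mul_abs_sub_le (hγ : IsCurveFamily Θ α C₁ C₂ C₃ γ) (x x' : ℝ) {t t' θ θ' : ℝ}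
    (ht : t ∈ Set.Icc (0 : ℝ) 1) (ht' : t' ∈ Set.Icc (0 : ℝ) 1) (hθ : θ ∈ Θ) (hθ' : θ' ∈ Θ) :
    C₁⁻¹ * |x - x'| ≤ |γ x t θ - γ x' t' θ'| + C₂ * |t - t'| ^ α + C₃ * |θ - θ'| := by
  have h1 := (hγ.bilipschitz x x' t ht θ hθ).1
  have h2 := hγ.holder x' t ht t' ht' θ hθ
  have h3 := hγ.lipschitz x' t' ht' θ hθ θ' hθ'
  have e : γ x t θ - γ x' t θ = (γ x t θ - γ x' t' θ') - (γ x' t θ - γ x' t' θ) -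
      (γ x' t' θ - γ x' t' θ') := by ring
  have h4 := abs_sub ((γ x t θ - γ x' t' θ') - (γ x' t θ - γ x' t' θ))
    (γ x' t' θ - γ x' t' θ')
  have h5 := abs_sub (γ x t θ - γ x' t' θ') (γ x' t θ - γ x' t' θ)
  rw [← e] at h4
  linarith

theorem continuous_space (hγ : IsCurveFamily Θ α C₁ C₂ C₃ γ) {t θ : ℝ}
    (ht : t ∈ Set.Icc (0 : ℝ) 1) (hθ : θ ∈ Θ) : Continuous fun x => γ x t θ :=
  (hγ.contDiff t ht θ hθ).continuous

theorem continuousOn_time_parameter (hγ : IsCurveFamily Θ α C₁ C₂ C₃ γ) (hα : 0 < α) (x : ℝ) :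
    ContinuousOn (fun z : ℝ × ℝ => γ x z.1 z.2) (Set.Icc (0 : ℝ) 1 ×ˢ Θ) := by
  rintro ⟨t₀, θ₀⟩ ⟨ht₀, hθ₀⟩
  rw [ContinuousWithinAt, tendsto_iff_dist_tendsto_zero]
  have hlim : Tendsto (fun z : ℝ × ℝ => C₂ * |z.1 - t₀| ^ α + C₃ * |z.2 - θ₀|)
      (𝓝[Set.Icc (0 : ℝ) 1 ×ˢ Θ] (t₀, θ₀)) (𝓝 0) := by
    have hc : Continuous fun z : ℝ × ℝ => C₂ * |z.1 - t₀| ^ α + C₃ * |z.2 - θ₀| := by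
      refine ((Continuous.rpow_const (by fun_prop) fun _ => Or.inr hα.le).const_mul C₂).add
        (by fun_prop)
    have := (hc.tendsto (t₀, θ₀)).mono_left
      (nhdsWithin_le_nhds (s := Set.Icc (0 : ℝ) 1 ×ˢ Θ))
    simpa [Real.zero_rpow hα.ne'] using this
  refine squeeze_zero' (Eventually.of_forall fun _ => dist_nonneg) ?_ hlim
  filter_upwards [self_mem_nhdsWithin] with z hz
  rw [Real.dist_eq]
  have h1 := hγ.holder x z.1 hz.1 t₀ ht₀ z.2 hz.2
  have h2 := hγ.lipschitz x t₀ ht₀ z.2 hz.2 θ₀ hθ₀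
  linarith [abs_sub_le (γ x z.1 z.2) (γ x t₀ z.2) (γ x t₀ θ₀)]

end IsCurveFamily

/-- The part of `∫ e^{i(yξ + tξ²)} h(ξ) dξ` from frequencies in `E`. -/
noncomputable def bandIntegral (E : Set ℝ) (h : ℝ → ℂ) (t y : ℝ) : ℂ :=
  ∫ ξ in E, phase t y ξ * h ξ

/-- `x ↦ sup_{t ∈ (0,1), θ ∈ Θ} |u(t, γ(x,t,θ))|`. -/
noncomputable def supAlong (Θ : Set ℝ) (γ : ℝ → ℝ → ℝ → ℝ) (u : ℝ → ℝ → ℂ) (x : ℝ) : ℝ≥0∞ :=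
  ⨆ t ∈ Set.Ioo (0 : ℝ) 1, ⨆ θ ∈ Θ, ‖u t (γ x t θ)‖ₑ

theorem le_supAlong {Θ : Set ℝ} (γ : ℝ → ℝ → ℝ → ℝ) (u : ℝ → ℝ → ℂ) (x : ℝ) {t θ : ℝ}
    (ht : t ∈ Set.Ioo (0 : ℝ) 1) (hθ : θ ∈ Θ) : ‖u t (γ x t θ)‖ₑ ≤ supAlong Θ γ u x :=
  le_iSup₂_of_le t ht (le_iSup₂_of_le θ hθ le_rfl)

theorem supAlong_le {Θ : Set ℝ} {γ : ℝ → ℝ → ℝ → ℝ} {u : ℝ → ℝ → ℂ} {x : ℝ} {B : ℝ≥0∞}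
    (h : ∀ t ∈ Set.Ioo (0 : ℝ) 1, ∀ θ ∈ Θ, ‖u t (γ x t θ)‖ₑ ≤ B) : supAlong Θ γ u x ≤ B :=
  iSup₂_le fun t ht => iSup₂_le fun θ hθ => h t ht θ hθ

theorem enorm_bandIntegral_le (E : Set ℝ) (h : ℝ → ℂ) (t y : ℝ) :
    ‖bandIntegral E h t y‖ₑ ≤ ∫⁻ ξ in E, ‖h ξ‖ₑ := by
  refine (enorm_integral_le_lintegral_enorm _).trans (le_of_eq (lintegral_congr fun ξ => ?_))
  rw [enorm_mul, ← ofReal_norm (phase t y ξ), norm_phase, ENNReal.ofReal_one, one_mul]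

theorem continuous_bandIntegral {E : Set ℝ} {h : ℝ → ℂ} (hh : IntegrableOn h E) :
    Continuous fun z : ℝ × ℝ => bandIntegral E h z.1 z.2 := by
  refine continuous_of_dominated (bound := fun ξ => ‖h ξ‖) (fun z => ?_) (fun z => ?_) hh.norm ?_
  · exact (continuous_phase_right z.1 z.2).aestronglyMeasurable.mul hh.aestronglyMeasurable
  · refine ae_of_all _ fun ξ => ?_
    rw [norm_mul, norm_phase, one_mul]
  · refine ae_of_all _ fun ξ => ?_
    exact (continuous_phase.comp (by fun_prop : Continuous fun z : ℝ × ℝ => (z.1, z.2, ξ))).mul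
      continuous_const

/-- Even an uncountable supremum of functions continuous in x is lower semicontinuous. -/
theorem measurable_supAlong {Θ : Set ℝ} {α C₁ C₂ C₃ : ℝ} {γ : ℝ → ℝ → ℝ → ℝ}
    (hγ : IsCurveFamily Θ α C₁ C₂ C₃ γ) {u : ℝ → ℝ → ℂ} (hu : ∀ t, Continuous (u t)) :
    Measurable (supAlong Θ γ u) := by
  refine LowerSemicontinuous.measurable (lowerSemicontinuous_biSup fun t ht =>
    lowerSemicontinuous_biSup fun θ hθ => Continuous.lowerSemicontinuous ?_)
  exact continuous_enorm.comp ((hu t).comp (hγ.continuous_space (Set.Ioo_subset_Icc_self ht) hθ))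

/-- A supremum over a separable space of parameters is attained, up to a factor `2`, along a
measurable selection from a dense sequence. -/
theorem exists_measurable_selection {S X : Type*} [TopologicalSpace S]
    [TopologicalSpace.SeparableSpace S] [Nonempty S] [MeasurableSpace X] {F : S → X → ℂ}
    (hF : ∀ s, Measurable (F s)) (hFc : ∀ x, Continuous fun s => F s x) {M : X → ℝ≥0∞}
    (hM : Measurable M) (hMtop : ∀ x, M x ≠ ∞) (hMF : ∀ x, M x ≤ ⨆ s, ‖F s x‖ₑ) :
    ∃ n : X → ℕ, Measurable n ∧
      ∀ x, M x ≤ 2 * ‖F (TopologicalSpace.denseSeq S (n x)) x‖ₑ := by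
  classical
  have hex : ∀ x, ∃ n, M x ≤ 2 * ‖F (TopologicalSpace.denseSeq S n) x‖ₑ := fun x => by
    -- Halving M makes room for a strict inequality, hence for an open set of good parameters, only
    -- when M x ≠ 0; otherwise any index serves.
    rcases eq_or_ne (M x) 0 with h0 | h0
    · exact ⟨0, by rw [h0]; exact zero_le⟩
    · have hlt : M x / 2 < ⨆ s, ‖F s x‖ₑ :=
        (ENNReal.half_lt_self h0 (hMtop x)).trans_le (hMF x)
      obtain ⟨s, hs⟩ := lt_iSup_iff.1 hlt
      have hopen : IsOpen {s | M x / 2 < ‖F s x‖ₑ} :=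
        isOpen_lt continuous_const (continuous_enorm.comp (hFc x))
      obtain ⟨n, hn⟩ := (TopologicalSpace.denseRange_denseSeq S).exists_mem_open hopen ⟨s, hs⟩
      refine ⟨n, ?_⟩
      rw [mul_comm]
      exact (ENNReal.div_le_iff (by norm_num) (by norm_num)).1 (le_of_lt hn)
  -- Taking the least admissible index makes the selection measurable.
  refine ⟨fun x => Nat.find (hex x), measurable_find hex fun k => ?_, fun x => Nat.find_spec (hex x)⟩
  exact measurableSet_le hM ((hF _).enorm.const_mul 2)

/-! ### One annulus, one small set of parameters -/

theorem lintegral_enorm_rpow_Ioo_lt_top {η : ℝ} (hη : 0 < η) :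
    ∫⁻ z in Set.Ioo (-1 : ℝ) 1, ‖z‖ₑ ^ (η - 1) < ∞ := by
  have hpos : ∫⁻ z in Set.Ioc (0 : ℝ) 1, ‖z‖ₑ ^ (η - 1) < ∞ := by
    have h1 : IntegrableOn (fun z : ℝ => z ^ (η - 1)) (Set.Ioc 0 1) :=
      (intervalIntegrable_iff_integrableOn_Ioc_of_le zero_le_one).1
        (intervalIntegral.intervalIntegrable_rpow' (by linarith))
    refine lt_of_le_of_lt (le_of_eq ?_) h1.2
    refine setLIntegral_congr_fun measurableSet_Ioc fun z hz => ?_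
    simp only
    rw [← ofReal_norm, ← ofReal_norm, Real.norm_of_nonneg hz.1.le,
      Real.norm_of_nonneg (Real.rpow_nonneg hz.1.le _), ENNReal.ofReal_rpow_of_pos hz.1]
  have hneg : ∫⁻ z in Set.Ico (-1 : ℝ) 0, ‖z‖ₑ ^ (η - 1) = ∫⁻ z in Set.Ioc (0 : ℝ) 1,
      ‖z‖ₑ ^ (η - 1) := by
    have := (Measure.measurePreserving_neg (volume : Measure ℝ)).setLIntegral_comp_preimage
      (s := Set.Ico (-1 : ℝ) 0) measurableSet_Ico
      (f := fun z : ℝ => ‖z‖ₑ ^ (η - 1)) (by fun_prop)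
    rw [← this]
    simp [enorm_neg]
  have hsub : Set.Ioo (-1 : ℝ) 1 ⊆ (Set.Ico (-1 : ℝ) 0 ∪ {0}) ∪ Set.Ioc (0 : ℝ) 1 := by
    intro z hz
    rcases lt_trichotomy z 0 with h | h | h
    · exact Or.inl (Or.inl ⟨hz.1.le, h⟩)
    · exact Or.inl (Or.inr h)
    · exact Or.inr ⟨h, hz.2.le⟩
  refine (lintegral_mono_set hsub).trans_lt ((lintegral_union_le _ _ _).trans_lt ?_)
  refine ENNReal.add_lt_top.2 ⟨(lintegral_union_le _ _ _).trans_lt ?_, hpos⟩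
  refine ENNReal.add_lt_top.2 ⟨hneg ▸ hpos, ?_⟩
  simp

/-- The integrals of `|x - ·|^{η-1}` over a ball are bounded independently of `x`. -/
theorem exists_lintegral_ball_enorm_sub_rpow_le {η : ℝ} (hη : 0 < η) (hη1 : η < 1) (x₀ r : ℝ) :
    ∃ A : ℝ≥0, ∀ x : ℝ, ∫⁻ x' in Metric.ball x₀ r, ‖x - x'‖ₑ ^ (η - 1) ≤ A := by
  -- Cut off at |z| < 1: beyond it |z|^{η-1} ≤ 1, so the ball's volume controls the rest and
  -- translation invariance makes the bound uniform in x.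
  set G : ℝ → ℝ≥0∞ := (Set.Ioo (-1 : ℝ) 1).indicator fun z => ‖z‖ₑ ^ (η - 1) with hG
  have hfin : ∫⁻ z, G z ≠ ∞ := by
    rw [hG, lintegral_indicator measurableSet_Ioo]
    exact (lintegral_enorm_rpow_Ioo_lt_top hη).ne
  have hGm : Measurable G := Measurable.indicator (by fun_prop) measurableSet_Ioo
  refine ⟨((∫⁻ z, G z) + volume (Metric.ball x₀ r)).toNNReal, fun x => ?_⟩
  rw [ENNReal.coe_toNNReal (ENNReal.add_ne_top.2 ⟨hfin, measure_ball_lt_top.ne⟩)]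
  have hle : ∀ z : ℝ, ‖z‖ₑ ^ (η - 1) ≤ G z + 1 := fun z => by
    by_cases hz : z ∈ Set.Ioo (-1 : ℝ) 1
    · rw [hG, Set.indicator_of_mem hz]
      exact le_self_add
    · refine le_add_left ?_
      have h1 : 1 ≤ ‖z‖ₑ := by
        rw [← ofReal_norm, Real.norm_eq_abs, ENNReal.one_le_ofReal]
        by_contra h
        exact hz (abs_lt.1 (not_le.1 h))
      have : η - 1 = -(1 - η) := by ring
      rw [this, ENNReal.rpow_neg, ENNReal.inv_le_one]
      exact ENNReal.one_le_rpow h1 (by linarith)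
  calc ∫⁻ x' in Metric.ball x₀ r, ‖x - x'‖ₑ ^ (η - 1)
      ≤ ∫⁻ x' in Metric.ball x₀ r, (G (x - x') + 1) := lintegral_mono fun x' => hle _
    _ = (∫⁻ x' in Metric.ball x₀ r, G (x - x')) + volume (Metric.ball x₀ r) := by
      rw [lintegral_add_right _ measurable_const, setLIntegral_one]
    _ ≤ (∫⁻ x', G (x - x')) + volume (Metric.ball x₀ r) := by
      gcongr
      exact Measure.restrict_le_self
    _ = (∫⁻ z, G z) + volume (Metric.ball x₀ r) := by
      rw [lintegral_sub_left_eq_self (fun z => G z) x]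

/-- The maximal estimate at frequencies `|ξ| ∼ ℓ` for parameters in a set of diameter `ℓ^{-m}`. -/
theorem exists_lintegral_supAlong_small_le {Θ : Set ℝ} {α C₁ C₂ C₃ q m σ η : ℝ} (hα : 0 < α)
    (hC₁ : 1 ≤ C₁) (hC₂ : 0 < C₂) (hC₃ : 0 < C₃) (hq1 : 1 ≤ q) (hq2 : q ≤ 2) (hαq : 2 * α ≤ q)
    (hmq : m ≤ q) (hσ : 1 / 2 ≤ 2 * σ) (hσα : 1 - 2 * α / q ≤ 2 * σ) (hσm : 1 - m / q ≤ 2 * σ)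
    (hη0 : 0 < η) (hη1 : η < 1) (x₀ : ℝ) {r : ℝ} (hr : 0 < r) :
    ∃ C : ℝ≥0, ∀ γ : ℝ → ℝ → ℝ → ℝ, IsCurveFamily Θ α C₁ C₂ C₃ γ → ∀ h : ℝ → ℂ, Measurable h →
      ∀ ℓ : ℝ, 1 ≤ ℓ → IntegrableOn h (annulus ℓ) → ∀ Θ' ⊆ Θ,
      (∀ θ ∈ Θ', ∀ θ' ∈ Θ', |θ - θ'| ≤ ℓ ^ (-m)) →
      ∫⁻ x in Metric.ball x₀ r, supAlong Θ' γ (bandIntegral (annulus ℓ) h) x ^ (2 * q) ≤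
        C * ENNReal.ofReal (ℓ ^ (2 * σ + η)) ^ q *
          (∫⁻ ξ in annulus ℓ, ‖h ξ‖ₑ ^ (2 : ℝ)) ^ q := by
  have hq0 : 0 < q := by linarith
  obtain ⟨C, hC0, hC⟩ := exists_kernel_bound hα hC₁ hC₂ hC₃ hq1 hq2 hαq hmq hσ hσα hσm hη0 hη1
    (by positivity : 0 < 2 * r)
  obtain ⟨A, hA⟩ := exists_lintegral_ball_enorm_sub_rpow_le hη0 hη1 x₀ r
  refine ⟨2 ^ (2 * q) * (C.toNNReal ^ q * A), fun γ hγ h hm ℓ hℓ hh Θ' hΘ' hdiam => ?_⟩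
  have hℓ0 : 0 < ℓ := by linarith
  rcases Set.eq_empty_or_nonempty Θ' with rfl | ⟨θ₀, hθ₀⟩
  · have : ∀ x, supAlong ∅ γ (bandIntegral (annulus ℓ) h) x ^ (2 * q) = 0 := fun x => by
      have : supAlong ∅ γ (bandIntegral (annulus ℓ) h) x = 0 :=
        le_antisymm (supAlong_le fun t _ θ hθ => hθ.elim) zero_le
      rw [this, ENNReal.zero_rpow_of_pos (by positivity)]
    simp [this]
  let S : Type := ↥(Set.Ioo (0 : ℝ) 1 ×ˢ Θ')
  have : Nonempty S := ⟨⟨(1 / 2, θ₀), ⟨by norm_num, by norm_num⟩, hθ₀⟩⟩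
  have hγ' : IsCurveFamily Θ' α C₁ C₂ C₃ γ :=
    ⟨fun x θ hθ => hγ.initial x θ (hΘ' hθ), fun t ht θ hθ => hγ.contDiff t ht θ (hΘ' hθ),
      fun x x' t ht θ hθ => hγ.bilipschitz x x' t ht θ (hΘ' hθ),
      fun x t ht t' ht' θ hθ => hγ.holder x t ht t' ht' θ (hΘ' hθ),
      fun x t ht θ hθ θ' hθ' => hγ.lipschitz x t ht θ (hΘ' hθ) θ' (hΘ' hθ')⟩
  have hIcc : ∀ s : S, s.1.1 ∈ Set.Icc (0 : ℝ) 1 := fun s => Set.Ioo_subset_Icc_self s.2.1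
  have hcont := continuous_bandIntegral hh
  set u := bandIntegral (annulus ℓ) h with hu
  have hut : ∀ t, Continuous (u t) := fun t =>
    hcont.comp (by fun_prop : Continuous fun y : ℝ => (t, y))
  obtain ⟨n, hn, hsel⟩ := exists_measurable_selection (S := S) (X := ℝ)
    (F := fun s x => u s.1.1 (γ x s.1.1 s.1.2)) (M := supAlong Θ' γ u)
    (fun s => ((hut _).comp (hγ'.continuous_space (hIcc s) s.2.2)).measurable)
    (fun x => by
      have h1 : Continuous fun s : S => γ x s.1.1 s.1.2 :=
        (hγ'.continuousOn_time_parameter hα x).comp_continuous continuous_subtype_val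
          fun s => ⟨hIcc s, s.2.2⟩
      exact hcont.comp ((continuous_fst.comp continuous_subtype_val).prodMk h1))
    (measurable_supAlong hγ' hut)
    (fun x => ne_top_of_le_ne_top hh.2.ne (supAlong_le fun t _ θ _ => enorm_bandIntegral_le _ _ _ _))
    (fun x => supAlong_le fun t ht θ hθ =>
      le_iSup (fun s : S => ‖u s.1.1 (γ x s.1.1 s.1.2)‖ₑ) ⟨(t, θ), ht, hθ⟩)
  set p : ℝ → S := fun x => TopologicalSpace.denseSeq S (n x) with hp
  set τ : ℝ → ℝ := fun x => (p x).1.1 with hτ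
  set y : ℝ → ℝ := fun x => γ x (p x).1.1 (p x).1.2 with hy
  have hτm : Measurable τ :=
    (measurable_from_nat (f := fun k => (TopologicalSpace.denseSeq S k).1.1)).comp hn
  -- Only countably many parameters are selected, so continuity in x for each of them suffices.
  have hym : Measurable y := by
    have h1 : Measurable fun z : ℝ × ℕ => γ z.1 (TopologicalSpace.denseSeq S z.2).1.1
        (TopologicalSpace.denseSeq S z.2).1.2 := by
      refine measurable_from_prod_countable_left fun k => ?_
      exact (hγ'.continuous_space (hIcc (TopologicalSpace.denseSeq S k))
        (TopologicalSpace.denseSeq S k).2.2).measurable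
    exact h1.comp (measurable_id.prodMk hn)
  have : IsFiniteMeasure (volume.restrict (annulus ℓ)) :=
    ⟨by rw [Measure.restrict_apply_univ]; exact volume_annulus_lt_top ℓ⟩
  have : IsFiniteMeasure (volume.restrict (Metric.ball x₀ r)) :=
    ⟨by rw [Measure.restrict_apply_univ]; exact measure_ball_lt_top⟩
  set B : ℝ := C * ℓ ^ (2 * σ + η) with hB
  have hB0 : 0 < B := by positivity
  set κ : ℝ := (1 - η) / q with hκ
  have hκ0 : 0 < κ := div_pos (by linarith) hq0
  let J : ℝ → ℝ → ℝ≥0∞ := fun x x' => ENNReal.ofReal B * ‖x - x'‖ₑ ^ (-κ)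
  have hJq : ∀ x x', J x x' ^ q = ENNReal.ofReal B ^ q * ‖x - x'‖ₑ ^ (η - 1) := fun x x' => by
    simp only [J]
    rw [ENNReal.mul_rpow_of_nonneg _ _ hq0.le, ← ENNReal.rpow_mul]
    congr 2
    rw [hκ]
    field_simp
    ring
  have hJint : ∀ x, ∫⁻ x' in Metric.ball x₀ r, J x x' ^ q ≤ ENNReal.ofReal B ^ q * A := fun x => by
    simp_rw [hJq]
    rw [lintegral_const_mul _ (by fun_prop)]
    gcongr
    exact hA x
  have hJsymm : ∀ x x', J x x' = J x' x := fun x x' => by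
    simp only [J]
    rw [← enorm_neg (x - x'), neg_sub]
  have key := lintegral_enorm_rpow_le_of_kernel_le (volume.restrict (Metric.ball x₀ r))
    (volume.restrict (annulus ℓ)) (Φ := fun x ξ => phase (τ x) (y x) ξ) (J := J) (q := q)
    (A := ENNReal.ofReal B ^ q * A)
    (by
      exact continuous_phase.measurable.comp ((hτm.comp measurable_fst).prodMk
        ((hym.comp measurable_fst).prodMk measurable_snd)))
    (fun x ξ => (norm_phase _ _ _).le)
    (by simp only [J, Function.uncurry_def]; fun_prop)
    (by
      rw [Measure.prod_restrict]
      filter_upwards [ae_restrict_mem (measurableSet_ball.prod measurableSet_ball)] with z hz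
      simp_rw [phase_mul_conj]
      -- On the diagonal J = ∞, since 0 to a negative power is ∞, and nothing is to be proved.
      rcases eq_or_ne z.1 z.2 with he | he
      · simp only [J]
        rw [he, sub_self z.2, enorm_zero, ENNReal.zero_rpow_of_neg (by linarith),
          ENNReal.mul_top (by simpa using hB0)]
        exact le_top
      · have hd : 0 < |z.1 - z.2| := abs_pos.2 (sub_ne_zero.2 he)
        have hdR : |z.1 - z.2| ≤ 2 * r := by
          have h1 := Metric.mem_ball.1 hz.1
          have h2 := Metric.mem_ball.1 hz.2
          have h3 := dist_triangle_right z.1 z.2 x₀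
          rw [← Real.dist_eq]
          linarith
        have hdist := hγ.inv_mul_abs_sub_le z.1 z.2 (hIcc (p z.1)) (hIcc (p z.2))
          (hΘ' (p z.1).2.2) (hΘ' (p z.2).2.2)
        have hθd := mul_le_mul_of_nonneg_left (hdiam _ (p z.1).2.2 _ (p z.2).2.2) hC₃.le
        have hV := hC ℓ (y z.1 - y z.2) (τ z.1 - τ z.2) |z.1 - z.2| _ hℓ hd hdR (norm_nonneg _)
          (hdist.trans (by simp only [hy, hτ]; linarith))
          (norm_kernel_le_frequency hℓ0.le (τ z.1 - τ z.2) (y z.1 - y z.2))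
          (fun hb => norm_kernel_le_time hℓ0.le hb _)
          (fun ha hab => norm_kernel_le_space hℓ0.le ha hab)
        rw [← ofReal_norm]
        refine (ENNReal.ofReal_le_ofReal hV).trans (le_of_eq ?_)
        simp only [J]
        rw [← mul_assoc, ENNReal.ofReal_mul hB0.le, ← ENNReal.ofReal_rpow_of_pos hd,
          ← ofReal_norm (z.1 - z.2), Real.norm_eq_abs])
    hq1 hJint (fun x' => by simp_rw [hJsymm _ x']; exact hJint x') hm hh
  calc ∫⁻ x in Metric.ball x₀ r, supAlong Θ' γ u x ^ (2 * q)
      ≤ ∫⁻ x in Metric.ball x₀ r, 2 ^ (2 * q) *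
        ‖∫ ξ in annulus ℓ, phase (τ x) (y x) ξ * h ξ‖ₑ ^ (2 * q) := by
        refine lintegral_mono fun x => ?_
        rw [← ENNReal.mul_rpow_of_nonneg _ _ (by positivity)]
        exact ENNReal.rpow_le_rpow (hsel x) (by positivity)
    _ = 2 ^ (2 * q) * ∫⁻ x in Metric.ball x₀ r,
        ‖∫ ξ in annulus ℓ, phase (τ x) (y x) ξ * h ξ‖ₑ ^ (2 * q) :=
        lintegral_const_mul' _ _ (ENNReal.rpow_ne_top_of_nonneg (by positivity) (by norm_num))
    _ ≤ 2 ^ (2 * q) * (ENNReal.ofReal B ^ q * A * (∫⁻ ξ in annulus ℓ, ‖h ξ‖ₑ ^ (2 : ℝ)) ^ q) := by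
        gcongr
    _ = _ := by
        rw [hB, ENNReal.ofReal_mul hC0.le, ENNReal.mul_rpow_of_nonneg _ _ hq0.le]
        push_cast
        rw [ENNReal.coe_rpow_of_nonneg _ (by positivity), ENNReal.coe_rpow_of_nonneg _ hq0.le]
        simp only [ENNReal.ofReal, ENNReal.coe_ofNat]
        ring

/-! ### Covering numbers and Minkowski dimension -/

theorem coe_coverCount {Θ : Set ℝ} (hΘ : IsCompact Θ) {δ : ℝ} (hδ : 0 < δ) :
    (coverCount Θ δ : ℕ∞) = Metric.externalCoveringNumber (δ / 2).toNNReal Θ := by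
  refine ENat.natCast_toNat ?_
  obtain ⟨C, -, hfin, hC⟩ := Metric.exists_finite_isCover_of_isCompact
    (ε := (δ / 2).toNNReal) (by simpa using hδ) hΘ
  exact ne_top_of_le_ne_top (Set.encard_ne_top_iff.2 hfin) hC.externalCoveringNumber_le_encard

theorem exists_finset_cover {Θ : Set ℝ} (hΘ : IsCompact Θ) {δ : ℝ} (hδ : 0 < δ) :
    ∃ c : Finset ℝ, c.card ≤ coverCount Θ δ ∧ ∀ θ ∈ Θ, ∃ z ∈ c, |θ - z| ≤ δ / 2 := by
  have h1 : Metric.externalCoveringNumber (δ / 2).toNNReal Θ < (coverCount Θ δ : ℕ∞) + 1 := by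
    rw [← coe_coverCount hΘ hδ]
    exact_mod_cast Nat.lt_succ_self _
  simp only [Metric.externalCoveringNumber, iInf_lt_iff] at h1
  obtain ⟨C, hC, hcard⟩ := h1
  have hle : C.encard ≤ (coverCount Θ δ : ℕ∞) := ENat.lt_add_one_iff (ENat.natCast_ne_top _) |>.1 hcard
  have hfin : C.Finite := Set.finite_of_encard_le_coe hle
  refine ⟨hfin.toFinset, ?_, fun θ hθ => ?_⟩
  · rw [hfin.encard_eq_coe_toFinset_card] at hle
    exact_mod_cast hle
  · rw [Metric.isCover_iff_subset_iUnion_closedBall] at hC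
    obtain ⟨z, hz, hzθ⟩ := Set.mem_iUnion₂.1 (hC hθ)
    refine ⟨z, hfin.mem_toFinset.2 hz, ?_⟩
    rw [Metric.mem_closedBall, Real.dist_eq, Real.coe_toNNReal _ (by positivity)] at hzθ
    exact hzθ

theorem coverCount_le_div {Θ : Set ℝ} (hΘ : IsCompact Θ) {R : ℝ} (hR : 0 ≤ R)
    (hΘR : ∀ θ ∈ Θ, |θ| ≤ R) {δ : ℝ} (hδ : 0 < δ) (hδ1 : δ ≤ 1) :
    (coverCount Θ δ : ℝ) ≤ (2 * R + 5) / δ := by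
  set K : ℕ := ⌈R / δ⌉₊ + 1 with hK
  have hKle : (K : ℝ) ≤ R / δ + 2 := by
    rw [hK]
    push_cast
    linarith [Nat.ceil_lt_add_one (div_nonneg hR hδ.le)]
  have hKge : R / δ + 1 ≤ K := by
    rw [hK]
    push_cast
    linarith [Nat.le_ceil (R / δ)]
  let c : Finset ℝ := (Finset.Icc (-(K : ℤ)) K).image fun k : ℤ => (k : ℝ) * δ
  have hcover : Metric.IsCover (δ / 2).toNNReal Θ (c : Set ℝ) := by
    rw [Metric.isCover_iff_subset_iUnion_closedBall]
    intro θ hθ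
    have hround := abs_sub_round (θ / δ)
    have hθδ : |θ / δ| ≤ R / δ := by
      rw [abs_div, abs_of_pos hδ]
      exact div_le_div_of_nonneg_right (hΘR θ hθ) hδ.le
    refine Set.mem_iUnion₂.2 ⟨(round (θ / δ) : ℝ) * δ, ?_, ?_⟩
    · refine Finset.mem_coe.2 (Finset.mem_image.2 ⟨round (θ / δ), ?_, rfl⟩)
      rw [Finset.mem_Icc]
      rw [abs_le] at hround hθδ
      constructor
      · have : (-(K : ℝ)) ≤ (round (θ / δ) : ℝ) := by linarith
        exact_mod_cast this
      · have : (round (θ / δ) : ℝ) ≤ (K : ℝ) := by linarith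
        exact_mod_cast this
    · rw [Metric.mem_closedBall, Real.dist_eq, Real.coe_toNNReal _ (by positivity)]
      have : θ - (round (θ / δ) : ℝ) * δ = (θ / δ - round (θ / δ)) * δ := by field_simp
      rw [this, abs_mul, abs_of_pos hδ]
      nlinarith
  have hcard : coverCount Θ δ ≤ c.card := by
    have := hcover.externalCoveringNumber_le_encard
    rw [← coe_coverCount hΘ hδ, Set.encard_coe_eq_coe_finsetCard] at this
    exact_mod_cast this
  have hcard' : c.card ≤ 2 * K + 1 := by
    refine Finset.card_image_le.trans ?_
    rw [Int.card_Icc]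
    omega
  have : (coverCount Θ δ : ℝ) ≤ 2 * K + 1 := by exact_mod_cast hcard.trans hcard'
  rw [le_div_iff₀ hδ]
  have h2 : (2 * R / δ + 5) * δ ≤ 2 * R + 5 := by
    have : (2 * R / δ + 5) * δ = 2 * R + 5 * δ := by field_simp
    linarith
  refine le_trans (mul_le_mul_of_nonneg_right ?_ hδ.le) h2
  have : 2 * R / δ = 2 * (R / δ) := by ring
  linarith

/-- A real `limsup` carries information only for a quotient bounded above; N(δ) ≲ 1/δ supplies the
bound. -/
theorem isBoundedUnder_log_coverCount {Θ : Set ℝ} (hΘ : IsCompact Θ) :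
    IsBoundedUnder (· ≤ ·) (𝓝[>] (0 : ℝ))
      fun δ : ℝ => Real.log (coverCount Θ δ) / (-Real.log δ) := by
  obtain ⟨R₀, hR₀⟩ := hΘ.isBounded.exists_norm_le
  set R := max R₀ 0 with hR
  have hR0 : 0 ≤ R := le_max_right _ _
  have hΘR : ∀ θ ∈ Θ, |θ| ≤ R := fun θ hθ => (hR₀ θ hθ).trans (le_max_left _ _)
  refine ⟨Real.log (2 * R + 5) + 1, ?_⟩
  rw [eventually_map]
  filter_upwards [Ioo_mem_nhdsGT (Real.exp_pos (-1))] with δ hδ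
  have hlog : 1 ≤ -Real.log δ := by
    have := Real.log_lt_log hδ.1 hδ.2
    rw [Real.log_exp] at this
    linarith
  have hδ1 : δ ≤ 1 := hδ.2.le.trans (Real.exp_le_one_iff.2 (by norm_num))
  have hL : 0 ≤ Real.log (2 * R + 5) := Real.log_nonneg (by linarith)
  rw [div_le_iff₀ (by linarith)]
  rcases Nat.eq_zero_or_pos (coverCount Θ δ) with h0 | h0
  · rw [h0, Nat.cast_zero, Real.log_zero]
    nlinarith
  · have h1 := Real.log_le_log (by exact_mod_cast h0) (coverCount_le_div hΘ hR0 hΘR hδ.1 hδ1)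
    rw [Real.log_div (by linarith) hδ.1.ne'] at h1
    nlinarith

theorem upperMinkowskiDim_nonneg {Θ : Set ℝ} (hΘ : IsCompact Θ) : 0 ≤ upperMinkowskiDim Θ := by
  refine le_limsup_of_le (isBoundedUnder_log_coverCount hΘ) fun b hb => ?_
  obtain ⟨δ, hδ, hδ'⟩ := (hb.and (Ioo_mem_nhdsGT one_pos)).exists
  refine le_trans (div_nonneg (Real.log_natCast_nonneg _) ?_) hδ
  have := Real.log_nonpos hδ'.1.le hδ'.2.le
  linarith

/-- The limsup gives N(δ) ≤ δ^{-b} for small δ; the finitely many remaining scales go into the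
constant. -/
theorem exists_coverCount_le {Θ : Set ℝ} (hΘ : IsCompact Θ) {m b : ℝ} (hm : 0 < m)
    (hb : upperMinkowskiDim Θ < b) :
    ∃ C : ℝ≥0, ∀ n : ℕ, (coverCount Θ (((2 : ℝ) ^ n) ^ (-m)) : ℝ) ≤
      C * ((2 : ℝ) ^ n) ^ (m * b) := by
  have hev : ∀ᶠ δ in 𝓝[>] (0 : ℝ), (coverCount Θ δ : ℝ) ≤ δ ^ (-b) := by
    filter_upwards [eventually_lt_of_limsup_lt hb (isBoundedUnder_log_coverCount hΘ),
      Ioo_mem_nhdsGT one_pos] with δ hδ hδ1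
    have hlog : 0 < -Real.log δ := by linarith [Real.log_neg hδ1.1 hδ1.2]
    rw [div_lt_iff₀ hlog] at hδ
    rcases Nat.eq_zero_or_pos (coverCount Θ δ) with h0 | h0
    · rw [h0, Nat.cast_zero]
      exact Real.rpow_nonneg hδ1.1.le _
    · refine (Real.le_rpow_iff_log_le (by exact_mod_cast h0) hδ1.1).2 ?_
      linarith
  have hlim : Tendsto (fun n : ℕ => ((2 : ℝ) ^ n) ^ (-m)) atTop (𝓝[>] 0) := by
    refine tendsto_nhdsWithin_iff.2 ⟨?_, Eventually.of_forall fun n => ?_⟩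
    · exact (tendsto_rpow_neg_atTop hm).comp (tendsto_pow_atTop_atTop_of_one_lt one_lt_two)
    · exact Real.rpow_pos_of_pos (by positivity) _
  obtain ⟨N, hN⟩ := eventually_atTop.1 (hlim.eventually hev)
  set u : ℕ → ℝ := fun n => (coverCount Θ (((2 : ℝ) ^ n) ^ (-m)) : ℝ) / ((2 : ℝ) ^ n) ^ (m * b)
    with hu
  have hpow : ∀ n : ℕ, (0 : ℝ) < ((2 : ℝ) ^ n) ^ (m * b) := fun n =>
    Real.rpow_pos_of_pos (by positivity) _
  have hu0 : ∀ n, 0 ≤ u n := fun n => div_nonneg (Nat.cast_nonneg _) (hpow n).le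
  have hsum : 0 ≤ ∑ k ∈ Finset.range N, u k := Finset.sum_nonneg fun k _ => hu0 k
  refine ⟨⟨1 + ∑ k ∈ Finset.range N, u k, by positivity⟩, fun n => ?_⟩
  rw [← div_le_iff₀ (hpow n)]
  change u n ≤ 1 + ∑ k ∈ Finset.range N, u k
  rcases lt_or_ge n N with hn | hn
  · have := Finset.single_le_sum (fun k _ => hu0 k) (Finset.mem_range.2 hn)
    linarith
  · have h1 : u n ≤ 1 := by
      rw [hu]
      dsimp only
      rw [div_le_one (hpow n)]
      refine (hN n hn).trans (le_of_eq ?_)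
      rw [← Real.rpow_mul (by positivity)]
      ring_nf
    linarith

/-! ### Summation over parameter pieces and frequencies -/

/-- The maximal estimate at frequencies `|ξ| ∼ 2ⁿ` over the whole parameter set. -/
theorem exists_lintegral_supAlong_annulus_le {Θ : Set ℝ} (hΘ : IsCompact Θ)
    {α C₁ C₂ C₃ q m σ η b : ℝ} (hα : 0 < α)
    (hC₁ : 1 ≤ C₁) (hC₂ : 0 < C₂) (hC₃ : 0 < C₃) (hq1 : 1 ≤ q) (hq2 : q ≤ 2) (hαq : 2 * α ≤ q)
    (hm0 : 0 < m) (hmq : m ≤ q) (hσ : 1 / 2 ≤ 2 * σ) (hσα : 1 - 2 * α / q ≤ 2 * σ)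
    (hσm : 1 - m / q ≤ 2 * σ) (hη0 : 0 < η) (hη1 : η < 1) (hb : upperMinkowskiDim Θ < b)
    (x₀ : ℝ) {r : ℝ} (hr : 0 < r) :
    ∃ C : ℝ≥0, ∀ γ : ℝ → ℝ → ℝ → ℝ, IsCurveFamily Θ α C₁ C₂ C₃ γ → ∀ h : ℝ → ℂ, Measurable h →
      ∀ n : ℕ, IntegrableOn h (annulus (2 ^ n)) →
      ∫⁻ x in Metric.ball x₀ r, supAlong Θ γ (bandIntegral (annulus (2 ^ n)) h) x ^ (2 * q) ≤
        C * ENNReal.ofReal (((2 : ℝ) ^ n) ^ (m * b + (2 * σ + η) * q)) *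
          (∫⁻ ξ in annulus (2 ^ n), ‖h ξ‖ₑ ^ (2 : ℝ)) ^ q := by
  obtain ⟨C, hC⟩ := exists_lintegral_supAlong_small_le (Θ := Θ) hα hC₁ hC₂ hC₃ hq1 hq2 hαq hmq hσ
    hσα hσm hη0 hη1 x₀ hr
  obtain ⟨N, hN⟩ := exists_coverCount_le hΘ hm0 hb
  refine ⟨N * C, fun γ hγ h hm n hh => ?_⟩
  have hℓ : (1 : ℝ) ≤ 2 ^ n := one_le_pow₀ one_le_two
  have hδ : (0 : ℝ) < ((2 : ℝ) ^ n) ^ (-m) := Real.rpow_pos_of_pos (by positivity) _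
  obtain ⟨c, hcard, hcover⟩ := exists_finset_cover hΘ hδ
  set δ : ℝ := ((2 : ℝ) ^ n) ^ (-m) with hδdef
  set u := bandIntegral (annulus (2 ^ n)) h with hu
  let Θ' : ℝ → Set ℝ := fun z => {θ ∈ Θ | |θ - z| ≤ δ / 2}
  have hut : ∀ t, Continuous (u t) := fun t =>
    (continuous_bandIntegral hh).comp (by fun_prop : Continuous fun y : ℝ => (t, y))
  have hγ' : ∀ z, IsCurveFamily (Θ' z) α C₁ C₂ C₃ γ := fun z =>
    ⟨fun x θ hθ => hγ.initial x θ hθ.1, fun t ht θ hθ => hγ.contDiff t ht θ hθ.1,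
      fun x x' t ht θ hθ => hγ.bilipschitz x x' t ht θ hθ.1,
      fun x t ht t' ht' θ hθ => hγ.holder x t ht t' ht' θ hθ.1,
      fun x t ht θ hθ θ' hθ' => hγ.lipschitz x t ht θ hθ.1 θ' hθ'.1⟩
  have hp0 : 0 < 2 * q := by linarith
  -- A supremum over the pieces is at most the sum of 2q-th powers, so only the number of pieces is
  -- lost.
  have hpt : ∀ x, supAlong Θ γ u x ^ (2 * q) ≤ ∑ z ∈ c, supAlong (Θ' z) γ u x ^ (2 * q) :=
    fun x => by
      rw [← ENNReal.le_rpow_inv_iff hp0]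
      refine supAlong_le fun t ht θ hθ => ?_
      obtain ⟨z, hz, hzθ⟩ := hcover θ hθ
      rw [ENNReal.le_rpow_inv_iff hp0]
      refine le_trans (ENNReal.rpow_le_rpow (le_supAlong γ u x ht ?_) hp0.le)
        (Finset.single_le_sum (f := fun z => supAlong (Θ' z) γ u x ^ (2 * q))
          (fun _ _ => zero_le) hz)
      exact ⟨hθ, hzθ⟩
  set H := ∫⁻ ξ in annulus (2 ^ n), ‖h ξ‖ₑ ^ (2 : ℝ) with hH
  set P := C * ENNReal.ofReal (((2 : ℝ) ^ n) ^ (2 * σ + η)) ^ q * H ^ q with hP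
  calc ∫⁻ x in Metric.ball x₀ r, supAlong Θ γ u x ^ (2 * q)
      ≤ ∫⁻ x in Metric.ball x₀ r, ∑ z ∈ c, supAlong (Θ' z) γ u x ^ (2 * q) := lintegral_mono hpt
    _ = ∑ z ∈ c, ∫⁻ x in Metric.ball x₀ r, supAlong (Θ' z) γ u x ^ (2 * q) :=
        lintegral_finsetSum _ fun z _ => (measurable_supAlong (hγ' z) hut).pow_const _
    _ ≤ ∑ z ∈ c, P := by
        refine Finset.sum_le_sum fun z _ => hC γ hγ h hm (2 ^ n) hℓ hh (Θ' z) (fun θ hθ => hθ.1) ?_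
        intro θ hθ θ' hθ'
        have h1 := hθ.2
        have h2 := hθ'.2
        rw [abs_sub_comm] at h2
        linarith [abs_sub_le θ z θ']
    _ = (c.card : ℝ≥0∞) * P := by rw [Finset.sum_const, nsmul_eq_mul]
    _ ≤ (N * ENNReal.ofReal (((2 : ℝ) ^ n) ^ (m * b))) * P := by
        gcongr
        have h1 : (c.card : ℝ) ≤ N * ((2 : ℝ) ^ n) ^ (m * b) :=
          le_trans (Nat.cast_le.2 hcard) (hN n)
        have h2 := ENNReal.ofReal_le_ofReal h1
        rwa [ENNReal.ofReal_natCast, ENNReal.ofReal_mul N.coe_nonneg, ENNReal.ofReal_coe_nnreal] at h2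
    _ = _ := by
        have hpos : (0 : ℝ) < 2 ^ n := by positivity
        rw [hP, Real.rpow_add hpos (m * b) ((2 * σ + η) * q), Real.rpow_mul hpos.le (2 * σ + η) q,
          ENNReal.ofReal_mul (by positivity),
          ← ENNReal.ofReal_rpow_of_nonneg (by positivity : (0 : ℝ) ≤ (2 ^ n) ^ (2 * σ + η))
            (by linarith : 0 ≤ q)]
        push_cast
        ring

/-- A series whose terms have geometrically decaying `L^p` norms. -/
theorem lintegral_tsum_rpow_le {X : Type*} [MeasurableSpace X] {μ : Measure X} {M : ℕ → X → ℝ≥0∞}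
    (hM : ∀ n, Measurable (M n)) {p : ℝ} (hp : 0 < p) {ρ : ℝ≥0∞} (hρ0 : ρ ≠ 0) (hρ1 : ρ < 1)
    {D : ℝ≥0∞} (hD : ∀ n, ∫⁻ x, M n x ^ p ∂μ ≤ D * (ρ ^ n) ^ (2 * p)) :
    ∫⁻ x, (∑' n, M n x) ^ p ∂μ ≤ (1 - ρ)⁻¹ ^ p * (1 - ρ ^ p)⁻¹ * D := by
  have hρtop : ρ ≠ ∞ := (hρ1.trans ENNReal.one_lt_top).ne
  have hρn0 : ∀ n : ℕ, ρ ^ n ≠ 0 := fun n => pow_ne_zero n hρ0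
  have hρntop : ∀ n : ℕ, ρ ^ n ≠ ∞ := fun n => ENNReal.pow_ne_top hρtop
  -- Half of the decay ρ^{2pn} is spent on a pointwise geometric series, half on summing the
  -- integrals; this works for every p > 0.
  have hpt : ∀ x, (∑' n, M n x) ^ p ≤ (1 - ρ)⁻¹ ^ p * ∑' n, ((ρ ^ n)⁻¹ * M n x) ^ p := fun x => by
    set T := ∑' n, ((ρ ^ n)⁻¹ * M n x) ^ p with hT
    have h1 : ∀ n, M n x ≤ ρ ^ n * T ^ p⁻¹ := fun n => by
      have h2 : (ρ ^ n)⁻¹ * M n x ≤ T ^ p⁻¹ := by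
        rw [ENNReal.le_rpow_inv_iff hp]
        exact ENNReal.le_tsum (f := fun n => ((ρ ^ n)⁻¹ * M n x) ^ p) n
      calc M n x = ρ ^ n * ((ρ ^ n)⁻¹ * M n x) := by
            rw [← mul_assoc, ENNReal.mul_inv_cancel (hρn0 n) (hρntop n), one_mul]
        _ ≤ _ := by gcongr
    calc (∑' n, M n x) ^ p ≤ (∑' n, ρ ^ n * T ^ p⁻¹) ^ p :=
          ENNReal.rpow_le_rpow (ENNReal.tsum_le_tsum h1) hp.le
      _ = (1 - ρ)⁻¹ ^ p * T := by
          rw [ENNReal.tsum_mul_right, ENNReal.tsum_geometric, ENNReal.mul_rpow_of_nonneg _ _ hp.le,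
            ENNReal.rpow_inv_rpow hp.ne']
  have hc : (1 - ρ)⁻¹ ^ p ≠ ∞ :=
    ENNReal.rpow_ne_top_of_nonneg hp.le (ENNReal.inv_ne_top.2 (tsub_pos_of_lt hρ1).ne')
  have hterm : ∀ n, ∫⁻ x, ((ρ ^ n)⁻¹ * M n x) ^ p ∂μ ≤ (ρ ^ p) ^ n * D := fun n => by
    simp_rw [ENNReal.mul_rpow_of_nonneg _ _ hp.le]
    rw [lintegral_const_mul _ ((hM n).pow_const p)]
    calc ((ρ ^ n)⁻¹) ^ p * ∫⁻ x, M n x ^ p ∂μ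
        ≤ ((ρ ^ n)⁻¹) ^ p * (D * (ρ ^ n) ^ (2 * p)) := by gcongr; exact hD n
      _ = (ρ ^ p) ^ n * D := by
        have h1 : ((ρ ^ n)⁻¹) ^ p * (ρ ^ n) ^ p = 1 := by
          rw [← ENNReal.mul_rpow_of_nonneg _ _ hp.le,
            ENNReal.inv_mul_cancel (hρn0 n) (hρntop n), ENNReal.one_rpow]
        have h2 : (ρ ^ n) ^ p = (ρ ^ p) ^ n := by
          rw [← ENNReal.rpow_natCast, ← ENNReal.rpow_natCast, ← ENNReal.rpow_mul,
            ← ENNReal.rpow_mul, mul_comm]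
        rw [two_mul, ENNReal.rpow_add_of_nonneg _ _ hp.le hp.le, ← h2]
        calc _ = (((ρ ^ n)⁻¹) ^ p * (ρ ^ n) ^ p) * ((ρ ^ n) ^ p * D) := by ring
          _ = _ := by rw [h1, one_mul]
  calc ∫⁻ x, (∑' n, M n x) ^ p ∂μ
      ≤ ∫⁻ x, (1 - ρ)⁻¹ ^ p * ∑' n, ((ρ ^ n)⁻¹ * M n x) ^ p ∂μ := lintegral_mono hpt
    _ = (1 - ρ)⁻¹ ^ p * ∑' n, ∫⁻ x, ((ρ ^ n)⁻¹ * M n x) ^ p ∂μ := by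
        rw [lintegral_const_mul' _ _ hc, lintegral_tsum fun n =>
          (((hM n).const_mul _).pow_const p).aemeasurable]
    _ ≤ (1 - ρ)⁻¹ ^ p * ∑' n, (ρ ^ p) ^ n * D := by
        gcongr
        exact hterm _
    _ = (1 - ρ)⁻¹ ^ p * (1 - ρ ^ p)⁻¹ * D := by
        rw [ENNReal.tsum_mul_right, ENNReal.tsum_geometric, mul_assoc]

/-- The squared Sobolev norm of the function with Fourier transform `h`. -/
noncomputable def energy (s : ℝ) (h : ℝ → ℂ) : ℝ≥0∞ :=
  ∫⁻ ξ, ‖(((1 + ξ ^ 2) ^ (s / 2) : ℝ) : ℂ) * h ξ‖ₑ ^ (2 : ℝ)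

theorem enorm_weight_mul_rpow_two (s : ℝ) (h : ℝ → ℂ) (ξ : ℝ) :
    ‖(((1 + ξ ^ 2) ^ (s / 2) : ℝ) : ℂ) * h ξ‖ₑ ^ (2 : ℝ) =
      ENNReal.ofReal ((1 + ξ ^ 2) ^ s) * ‖h ξ‖ₑ ^ (2 : ℝ) := by
  have h0 : (0 : ℝ) ≤ 1 + ξ ^ 2 := by positivity
  rw [enorm_mul, ENNReal.mul_rpow_of_nonneg _ _ (by norm_num), ← ofReal_norm, Complex.norm_real,
    Real.norm_of_nonneg (by positivity), ENNReal.ofReal_rpow_of_nonneg (by positivity) (by norm_num),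
    ← Real.rpow_mul h0]
  ring_nf

theorem lintegral_enorm_rpow_two_le_energy {s : ℝ} (hs : 0 ≤ s) (h : ℝ → ℂ) :
    ∫⁻ ξ, ‖h ξ‖ₑ ^ (2 : ℝ) ≤ energy s h := by
  refine lintegral_mono fun ξ => ?_
  rw [enorm_weight_mul_rpow_two]
  refine le_mul_of_one_le_left zero_le ?_
  rw [ENNReal.one_le_ofReal]
  exact Real.one_le_rpow (by nlinarith [sq_nonneg ξ]) hs

theorem lintegral_annulus_le_energy {s : ℝ} (hs : 0 ≤ s) (h : ℝ → ℂ) {ℓ : ℝ} (hℓ : 0 < ℓ) :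
    ∫⁻ ξ in annulus ℓ, ‖h ξ‖ₑ ^ (2 : ℝ) ≤ ENNReal.ofReal (ℓ ^ (-(2 * s))) * energy s h := by
  have hpt : ∀ ξ ∈ annulus ℓ, ‖h ξ‖ₑ ^ (2 : ℝ) ≤ ENNReal.ofReal (ℓ ^ (-(2 * s))) *
      ‖(((1 + ξ ^ 2) ^ (s / 2) : ℝ) : ℂ) * h ξ‖ₑ ^ (2 : ℝ) := fun ξ hξ => by
    rw [enorm_weight_mul_rpow_two, ← mul_assoc, ← ENNReal.ofReal_mul (by positivity)]
    refine le_mul_of_one_le_left zero_le ?_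
    rw [ENNReal.one_le_ofReal]
    have h1 : ℓ < |ξ| := by
      by_contra hle
      exact hξ.2 (abs_le.1 (not_lt.1 hle))
    have h2 : ℓ ^ (2 * s) ≤ (1 + ξ ^ 2) ^ s := by
      rw [Real.rpow_mul hℓ.le]
      refine Real.rpow_le_rpow (by positivity) ?_ hs
      have : ℓ ^ (2 : ℝ) = ℓ ^ 2 := Real.rpow_natCast ℓ 2
      rw [this, ← sq_abs ξ]
      nlinarith
    calc (1 : ℝ) = ℓ ^ (-(2 * s)) * ℓ ^ (2 * s) := by
          rw [← Real.rpow_add hℓ, neg_add_cancel, Real.rpow_zero]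
      _ ≤ _ := by gcongr
  calc ∫⁻ ξ in annulus ℓ, ‖h ξ‖ₑ ^ (2 : ℝ)
      ≤ ∫⁻ ξ in annulus ℓ, ENNReal.ofReal (ℓ ^ (-(2 * s))) *
        ‖(((1 + ξ ^ 2) ^ (s / 2) : ℝ) : ℂ) * h ξ‖ₑ ^ (2 : ℝ) :=
        setLIntegral_mono' (measurableSet_annulus ℓ) hpt
    _ = ENNReal.ofReal (ℓ ^ (-(2 * s))) * ∫⁻ ξ in annulus ℓ,
        ‖(((1 + ξ ^ 2) ^ (s / 2) : ℝ) : ℂ) * h ξ‖ₑ ^ (2 : ℝ) :=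
        lintegral_const_mul' _ _ ENNReal.ofReal_ne_top
    _ ≤ _ := by
        gcongr
        exact setLIntegral_le_lintegral _ _

theorem memLp_two_of_energy_lt_top {s : ℝ} (hs : 0 ≤ s) {h : ℝ → ℂ} (hm : Measurable h)
    (hE : energy s h < ∞) : MemLp h 2 := by
  refine ⟨hm.aestronglyMeasurable, ?_⟩
  rw [eLpNorm_eq_lintegral_rpow_enorm_toReal (by norm_num) (by norm_num)]
  refine ENNReal.rpow_lt_top_of_nonneg (by positivity) ?_
  rw [ENNReal.toReal_ofNat]
  exact ((lintegral_enorm_rpow_two_le_energy hs h).trans_lt hE).ne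

theorem integrableOn_of_energy_lt_top {s : ℝ} (hs : 0 ≤ s) {h : ℝ → ℂ} (hm : Measurable h)
    (hE : energy s h < ∞) {E : Set ℝ} (hEf : volume E < ∞) : IntegrableOn h E := by
  have : IsFiniteMeasure (volume.restrict E) := ⟨by rwa [Measure.restrict_apply_univ]⟩
  exact ((memLp_two_of_energy_lt_top hs hm hE).restrict E).integrable one_le_two

/-- A bound, uniform in time and space, for all the partial sums of the frequency decomposition
along the curves. -/
noncomputable def majorant (Θ : Set ℝ) (γ : ℝ → ℝ → ℝ → ℝ) (h : ℝ → ℂ) (x : ℝ) : ℝ≥0∞ :=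
  (∫⁻ ξ in Set.Icc (-1 : ℝ) 1, ‖h ξ‖ₑ) +
    ∑' n : ℕ, supAlong Θ γ (bandIntegral (annulus (2 ^ n)) h) x

theorem lintegral_Icc_rpow_le_energy {s : ℝ} (hs : 0 ≤ s) {h : ℝ → ℂ} (hm : Measurable h) {q : ℝ}
    (hq : 0 ≤ q) :
    (∫⁻ ξ in Set.Icc (-1 : ℝ) 1, ‖h ξ‖ₑ) ^ (2 * q) ≤ 2 ^ q * energy s h ^ q := by
  have h1 := ENNReal.lintegral_mul_le_Lp_mul_Lq (volume.restrict (Set.Icc (-1 : ℝ) 1))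
    Real.HolderConjugate.two_two (f := fun _ => 1) (g := fun ξ => ‖h ξ‖ₑ)
    aemeasurable_const hm.enorm.aemeasurable
  simp only [Pi.mul_apply, one_mul, ENNReal.one_rpow, lintegral_const,
    Measure.restrict_apply_univ, Real.volume_Icc] at h1
  have h2 : ENNReal.ofReal (1 - -1) = 2 := by norm_num
  rw [h2] at h1
  have h3 : ∫⁻ ξ in Set.Icc (-1 : ℝ) 1, ‖h ξ‖ₑ ^ (2 : ℝ) ≤ energy s h :=
    (setLIntegral_le_lintegral _ _).trans (lintegral_enorm_rpow_two_le_energy hs h)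
  calc _ ≤ (2 ^ (1 / 2 : ℝ) * energy s h ^ (1 / 2 : ℝ)) ^ (2 * q) := by
        refine ENNReal.rpow_le_rpow (h1.trans ?_) (by positivity)
        gcongr
    _ = _ := by
        rw [ENNReal.mul_rpow_of_nonneg _ _ (by positivity), ← ENNReal.rpow_mul, ← ENNReal.rpow_mul]
        ring_nf

/-- The gap g between s and the critical exponent, scaled by 2q, pays for both losses: g/4 for
taking b > β and at most g/4 for η. A negative exponent e ≤ -g/2 remains at each dyadic frequency.
-/
theorem exists_lintegral_majorant_le {Θ : Set ℝ} (hΘ : IsCompact Θ)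
    {α C₁ C₂ C₃ q m σ s : ℝ} (hα : 0 < α)
    (hC₁ : 1 ≤ C₁) (hC₂ : 0 < C₂) (hC₃ : 0 < C₃) (hq1 : 1 ≤ q) (hq2 : q ≤ 2) (hαq : 2 * α ≤ q)
    (hm0 : 0 < m) (hmq : m ≤ q) (hσ : 1 / 2 ≤ 2 * σ) (hσα : 1 - 2 * α / q ≤ 2 * σ)
    (hσm : 1 - m / q ≤ 2 * σ) (hs0 : 0 ≤ s) (hs : σ + m * upperMinkowskiDim Θ / (2 * q) < s)
    (x₀ : ℝ) {r : ℝ} (hr : 0 < r) :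
    ∃ C : ℝ≥0, ∀ γ : ℝ → ℝ → ℝ → ℝ, IsCurveFamily Θ α C₁ C₂ C₃ γ → ∀ h : ℝ → ℂ, Measurable h →
      energy s h < ∞ →
      ∫⁻ x in Metric.ball x₀ r, majorant Θ γ h x ^ (2 * q) ≤ C * energy s h ^ q := by
  have hq0 : 0 < q := by linarith
  set β := upperMinkowskiDim Θ with hβ
  obtain ⟨g, hg0, hg⟩ : ∃ g : ℝ, 0 < g ∧ g = 2 * s * q - 2 * σ * q - m * β := by
    refine ⟨_, ?_, rfl⟩
    have h1 : (σ + m * β / (2 * q)) * (2 * q) < s * (2 * q) :=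
      mul_lt_mul_of_pos_right hs (by positivity)
    have h2 : (σ + m * β / (2 * q)) * (2 * q) = 2 * σ * q + m * β := by field_simp
    linarith
  set η : ℝ := min (1 / 2) (g / (4 * q)) with hη
  have hη0 : 0 < η := lt_min (by norm_num) (by positivity)
  have hη1 : η < 1 := (min_le_left _ _).trans_lt (by norm_num)
  have hηg : η * q ≤ g / 4 := by
    calc η * q ≤ g / (4 * q) * q := by
          gcongr
          exact min_le_right _ _
      _ = g / 4 := by field_simp
  obtain ⟨C, hC⟩ := exists_lintegral_supAlong_annulus_le hΘ hα hC₁ hC₂ hC₃ hq1 hq2 hαq hm0 hmq hσ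
    hσα hσm hη0 hη1 (b := β + g / (4 * m)) (by
      have : 0 < g / (4 * m) := by positivity
      linarith) x₀ hr
  set e : ℝ := m * (β + g / (4 * m)) + (2 * σ + η) * q - 2 * s * q with he
  have he0 : e < 0 := by
    have : m * (β + g / (4 * m)) = m * β + g / 4 := by field_simp
    nlinarith
  -- Chosen so that (ρⁿ)^{2·2q} = 2^{ne}, the form required for summing the series.
  set ρ : ℝ≥0∞ := ENNReal.ofReal ((2 : ℝ) ^ (e / (2 * (2 * q)))) with hρ
  have hρ0 : ρ ≠ 0 := by
    rw [hρ]
    simpa using Real.rpow_pos_of_pos two_pos _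
  have hρ1 : ρ < 1 := by
    rw [hρ, ENNReal.ofReal_lt_one]
    exact Real.rpow_lt_one_of_one_lt_of_neg one_lt_two (div_neg_of_neg_of_pos he0 (by positivity))
  set K : ℝ≥0∞ := (1 - ρ)⁻¹ ^ (2 * q) * (1 - ρ ^ (2 * q))⁻¹ with hK
  have hKtop : K ≠ ∞ := by
    refine ENNReal.mul_ne_top (ENNReal.rpow_ne_top_of_nonneg (by positivity)
      (ENNReal.inv_ne_top.2 (tsub_pos_of_lt hρ1).ne')) (ENNReal.inv_ne_top.2 (tsub_pos_of_lt ?_).ne')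
    exact ENNReal.rpow_lt_one hρ1 (by positivity)
  set A : ℝ≥0∞ := 2 ^ (2 * q - 1) *
    (2 ^ q * volume (Metric.ball x₀ r) + K * C) with hA
  have hAtop : A ≠ ∞ := by
    refine ENNReal.mul_ne_top (ENNReal.rpow_ne_top_of_nonneg (by linarith) (by norm_num))
      (ENNReal.add_ne_top.2 ⟨ENNReal.mul_ne_top (ENNReal.rpow_ne_top_of_nonneg hq0.le (by norm_num))
        measure_ball_lt_top.ne, ENNReal.mul_ne_top hKtop ENNReal.coe_ne_top⟩)
  refine ⟨A.toNNReal, fun γ hγ h hm hE => ?_⟩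
  rw [ENNReal.coe_toNNReal hAtop]
  have hint : ∀ n : ℕ, IntegrableOn h (annulus (2 ^ n)) := fun n =>
    integrableOn_of_energy_lt_top hs0 hm hE (volume_annulus_lt_top _)
  have hMm : ∀ n : ℕ, Measurable (supAlong Θ γ (bandIntegral (annulus (2 ^ n)) h)) := fun n =>
    measurable_supAlong hγ fun t => (continuous_bandIntegral (hint n)).comp
      (by fun_prop : Continuous fun y : ℝ => (t, y))
  have hpiece : ∀ n : ℕ, ∫⁻ x in Metric.ball x₀ r,
      supAlong Θ γ (bandIntegral (annulus (2 ^ n)) h) x ^ (2 * q) ≤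
        (C * energy s h ^ q) * (ρ ^ n) ^ (2 * (2 * q)) := fun n => by
    have hpos : (0 : ℝ) < 2 ^ n := by positivity
    refine (hC γ hγ h hm n (hint n)).trans ?_
    calc _ ≤ C * ENNReal.ofReal (((2 : ℝ) ^ n) ^ (m * (β + g / (4 * m)) + (2 * σ + η) * q)) *
          (ENNReal.ofReal (((2 : ℝ) ^ n) ^ (-(2 * s))) * energy s h) ^ q := by
          gcongr
          exact lintegral_annulus_le_energy hs0 h hpos
      _ = C * energy s h ^ q * ENNReal.ofReal (((2 : ℝ) ^ n) ^ e) := by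
          have h1 : ((2 : ℝ) ^ n) ^ e =
              ((2 : ℝ) ^ n) ^ (m * (β + g / (4 * m)) + (2 * σ + η) * q) *
                (((2 : ℝ) ^ n) ^ (-(2 * s))) ^ q := by
            rw [← Real.rpow_mul hpos.le, ← Real.rpow_add hpos]
            congr 1
            rw [he]
            ring
          rw [h1, ENNReal.mul_rpow_of_nonneg _ _ hq0.le, ENNReal.ofReal_mul (by positivity),
            ← ENNReal.ofReal_rpow_of_nonneg (by positivity) hq0.le]
          ring
      _ = _ := by
          congr 1
          rw [hρ, ← ENNReal.ofReal_pow (Real.rpow_nonneg zero_le_two _),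
            ENNReal.ofReal_rpow_of_nonneg (by positivity) (by positivity)]
          congr 1
          rw [← Real.rpow_natCast 2 n, ← Real.rpow_natCast (2 ^ (e / (2 * (2 * q)))) n,
            ← Real.rpow_mul zero_le_two, ← Real.rpow_mul zero_le_two, ← Real.rpow_mul zero_le_two]
          congr 1
          field_simp
  have hsum := lintegral_tsum_rpow_le (μ := volume.restrict (Metric.ball x₀ r)) hMm
    (by positivity : 0 < 2 * q) hρ0 hρ1 hpiece
  have hlow := lintegral_Icc_rpow_le_energy hs0 hm hq0.le
  set L := ∫⁻ ξ in Set.Icc (-1 : ℝ) 1, ‖h ξ‖ₑ with hL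
  calc ∫⁻ x in Metric.ball x₀ r, majorant Θ γ h x ^ (2 * q)
      ≤ ∫⁻ x in Metric.ball x₀ r, 2 ^ (2 * q - 1) * (L ^ (2 * q) +
        (∑' n : ℕ, supAlong Θ γ (bandIntegral (annulus (2 ^ n)) h) x) ^ (2 * q)) :=
        lintegral_mono fun x => ENNReal.rpow_add_le_mul_rpow_add_rpow _ _ (by linarith)
    _ = 2 ^ (2 * q - 1) * (L ^ (2 * q) * volume (Metric.ball x₀ r) + ∫⁻ x in Metric.ball x₀ r,
        (∑' n : ℕ, supAlong Θ γ (bandIntegral (annulus (2 ^ n)) h) x) ^ (2 * q)) := by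
        rw [lintegral_const_mul' _ _ (ENNReal.rpow_ne_top_of_nonneg (by linarith) (by norm_num)),
          lintegral_add_left measurable_const, setLIntegral_const]
    _ ≤ 2 ^ (2 * q - 1) * ((2 ^ q * energy s h ^ q) * volume (Metric.ball x₀ r) +
        K * (C * energy s h ^ q)) := by
        gcongr
    _ = A * energy s h ^ q := by
        rw [hA]
        ring

/-! ### Back to the Schrödinger evolution -/

theorem measurable_hat (f : Lp ℂ 2 (volume : Measure ℝ)) : Measurable (hat f) :=
  (Lp.stronglyMeasurable _).measurable.comp (measurable_id.div_const _)

theorem sobolevNorm_eq_energy_rpow (s : ℝ) (f : Lp ℂ 2 (volume : Measure ℝ)) :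
    sobolevNorm s f = energy s (hat f) ^ (1 / 2 : ℝ) := by
  rw [sobolevNorm, eLpNorm_eq_lintegral_rpow_enorm_toReal (by norm_num) (by norm_num),
    ENNReal.toReal_ofNat, energy]

theorem energy_lt_top_of_memH {s : ℝ} {f : Lp ℂ 2 (volume : Measure ℝ)} (hf : MemH s f) :
    energy s (hat f) < ∞ := by
  rw [MemH, sobolevNorm_eq_energy_rpow] at hf
  exact (ENNReal.rpow_lt_top_iff_of_pos (by norm_num)).1 hf

theorem schrodingerTrunc_eq_bandIntegral (f : Lp ℂ 2 (volume : Measure ℝ)) (k : ℕ) (t y : ℝ) :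
    schrodingerTrunc f k t y =
      (2 * Real.pi : ℂ)⁻¹ * bandIntegral (Set.Icc (-(2 : ℝ) ^ k) ((2 : ℝ) ^ k)) (hat f) t y :=
  rfl

theorem bandIntegral_Icc_eq_sum {h : ℝ → ℂ} (hh : ∀ R : ℝ, IntegrableOn h (Set.Icc (-R) R))
    (t y : ℝ) (k : ℕ) :
    bandIntegral (Set.Icc (-(2 : ℝ) ^ k) ((2 : ℝ) ^ k)) h t y =
      bandIntegral (Set.Icc (-1) 1) h t y +
        ∑ n ∈ Finset.range k, bandIntegral (annulus (2 ^ n)) h t y := by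
  induction k with
  | zero => simp
  | succ k ih =>
    have hint : IntegrableOn (fun ξ => phase t y ξ * h ξ)
        (Set.Icc (-(2 * (2 : ℝ) ^ k)) (2 * (2 : ℝ) ^ k)) := by
      refine (hh (2 * 2 ^ k)).bdd_mul (c := 1)
        (continuous_phase_right t y).aestronglyMeasurable (ae_of_all _ fun ξ => ?_)
      rw [norm_phase]
    have h1 := setIntegral_annulus (by positivity) hint
    rw [Finset.sum_range_succ, ← add_assoc, ← ih, pow_succ']
    simp only [bandIntegral] at h1 ⊢
    rw [h1]
    ring

theorem enorm_inv_two_pi_le_one : ‖(2 * Real.pi : ℂ)⁻¹‖ₑ ≤ 1 := by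
  rw [← ofReal_norm, ENNReal.ofReal_le_one, norm_inv, norm_mul, Complex.norm_real,
    Complex.norm_ofNat, Real.norm_of_nonneg Real.pi_pos.le]
  exact inv_le_one_of_one_le₀ (by linarith [Real.pi_gt_three])

section Pointwise

variable {Θ : Set ℝ} {γ : ℝ → ℝ → ℝ → ℝ} {f : Lp ℂ 2 (volume : Measure ℝ)} {x : ℝ}

/-- Where the majorant is finite, the truncated integrals converge uniformly along the curves. -/
theorem exists_tendsto_schrodingerTrunc
    (hh : ∀ R : ℝ, IntegrableOn (hat f) (Set.Icc (-R) R)) (hx : majorant Θ γ (hat f) x ≠ ∞)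
    {t θ : ℝ} (ht : t ∈ Set.Ioo (0 : ℝ) 1) (hθ : θ ∈ Θ) :
    ∃ z : ℂ, Tendsto (fun k : ℕ => schrodingerTrunc f k t (γ x t θ)) atTop (𝓝 z) ∧
      ∀ k : ℕ, ‖z - schrodingerTrunc f k t (γ x t θ)‖ₑ ≤
        ∑' n : ℕ, supAlong Θ γ (bandIntegral (annulus (2 ^ (n + k))) (hat f)) x := by
  set y := γ x t θ with hy
  set M : ℕ → ℝ≥0∞ := fun n => supAlong Θ γ (bandIntegral (annulus (2 ^ n)) (hat f)) x with hM
  have hMtop : ∑' n, M n ≠ ∞ := (ENNReal.add_ne_top.1 hx).2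
  set c : ℕ → ℂ := fun n => bandIntegral (annulus (2 ^ n)) (hat f) t y with hc
  have hcM : ∀ n, ‖c n‖ₑ ≤ M n := fun n => le_supAlong γ _ x ht hθ
  have hsum : Summable c := by
    refine Summable.of_nnnorm (ENNReal.tsum_coe_ne_top_iff_summable.1 ?_)
    exact ne_top_of_le_ne_top hMtop (ENNReal.tsum_le_tsum hcM)
  have htrunc : ∀ k, schrodingerTrunc f k t y = (2 * Real.pi : ℂ)⁻¹ *
      (bandIntegral (Set.Icc (-1) 1) (hat f) t y + ∑ n ∈ Finset.range k, c n) := fun k => by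
    rw [schrodingerTrunc_eq_bandIntegral, bandIntegral_Icc_eq_sum hh]
  refine ⟨(2 * Real.pi : ℂ)⁻¹ * (bandIntegral (Set.Icc (-1) 1) (hat f) t y + ∑' n, c n), ?_,
    fun k => ?_⟩
  · simp_rw [htrunc]
    exact (hsum.hasSum.tendsto_sum_nat.const_add _).const_mul _
  · rw [htrunc, ← mul_sub, add_sub_add_left_eq_sub, ← hsum.sum_add_tsum_nat_add k,
      add_sub_cancel_left, enorm_mul]
    calc _ ≤ 1 * ‖∑' n, c (n + k)‖ₑ := by
          gcongr
          exact enorm_inv_two_pi_le_one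
      _ ≤ ∑' n, ‖c (n + k)‖ₑ := by
          rw [one_mul]
          exact enorm_tsum_le_tsum_enorm
      _ ≤ _ := ENNReal.tsum_le_tsum fun n => hcM (n + k)

theorem schrodingerDefinedAt_of_majorant
    (hh : ∀ R : ℝ, IntegrableOn (hat f) (Set.Icc (-R) R)) (hx : majorant Θ γ (hat f) x ≠ ∞)
    {t θ : ℝ} (ht : t ∈ Set.Ioo (0 : ℝ) 1) (hθ : θ ∈ Θ) :
    SchrodingerDefinedAt f t (γ x t θ) :=
  let ⟨z, hz, _⟩ := exists_tendsto_schrodingerTrunc hh hx ht hθ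
  ⟨z, hz⟩

theorem enorm_schrodinger_sub_trunc_le
    (hh : ∀ R : ℝ, IntegrableOn (hat f) (Set.Icc (-R) R)) (hx : majorant Θ γ (hat f) x ≠ ∞)
    {t θ : ℝ} (ht : t ∈ Set.Ioo (0 : ℝ) 1) (hθ : θ ∈ Θ) (k : ℕ) :
    ‖schrodinger f t (γ x t θ) - schrodingerTrunc f k t (γ x t θ)‖ₑ ≤
      ∑' n : ℕ, supAlong Θ γ (bandIntegral (annulus (2 ^ (n + k))) (hat f)) x := by
  obtain ⟨z, hz, hzk⟩ := exists_tendsto_schrodingerTrunc hh hx ht hθ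
  rw [schrodinger, hz.limUnder_eq]
  exact hzk k

/-- The truncation at k = 0 is the low-frequency term and the rest is the dyadic tail. Where the
majorant is infinite the bound is trivial, so no exceptional set appears. -/
theorem maximalFunction_le_majorant
    (hh : ∀ R : ℝ, IntegrableOn (hat f) (Set.Icc (-R) R)) :
    maximalFunction Θ γ f x ≤ majorant Θ γ (hat f) x := by
  rcases eq_or_ne (majorant Θ γ (hat f) x) ∞ with hx | hx
  · rw [hx]
    exact le_top
  refine supAlong_le fun t ht θ hθ => ?_
  have h1 := enorm_schrodinger_sub_trunc_le hh hx ht hθ 0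
  have h2 : ‖schrodingerTrunc f 0 t (γ x t θ)‖ₑ ≤ ∫⁻ ξ in Set.Icc (-1 : ℝ) 1, ‖hat f ξ‖ₑ := by
    rw [schrodingerTrunc_eq_bandIntegral, enorm_mul, pow_zero]
    calc _ ≤ 1 * _ := mul_le_mul' enorm_inv_two_pi_le_one (enorm_bandIntegral_le _ _ _ _)
      _ = _ := one_mul _
  calc ‖schrodinger f t (γ x t θ)‖ₑ
      = ‖schrodingerTrunc f 0 t (γ x t θ) +
        (schrodinger f t (γ x t θ) - schrodingerTrunc f 0 t (γ x t θ))‖ₑ := by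
        rw [add_sub_cancel]
    _ ≤ _ := (enorm_add_le _ _).trans (add_le_add h2 h1)

/-- The tail bound is uniform in (t, θ) and so passes to suprema. It makes the maximal function an
a.e. limit of measurable ones. -/
theorem tendsto_supAlong_schrodingerTrunc
    (hh : ∀ R : ℝ, IntegrableOn (hat f) (Set.Icc (-R) R)) (hx : majorant Θ γ (hat f) x ≠ ∞) :
    Tendsto (fun k : ℕ => supAlong Θ γ (schrodingerTrunc f k) x) atTop
      (𝓝 (maximalFunction Θ γ f x)) := by
  set M : ℕ → ℝ≥0∞ := fun n => supAlong Θ γ (bandIntegral (annulus (2 ^ n)) (hat f)) x with hM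
  have hMtop : ∑' n, M n ≠ ∞ := (ENNReal.add_ne_top.1 hx).2
  have htail : Tendsto (fun k => ∑' n, M (n + k)) atTop (𝓝 0) :=
    ENNReal.tendsto_sum_nat_add M hMtop
  have hfin : maximalFunction Θ γ f x ≠ ∞ :=
    ne_top_of_le_ne_top hx (maximalFunction_le_majorant hh)
  have hlow : Tendsto (fun k => maximalFunction Θ γ f x - ∑' n, M (n + k)) atTop
      (𝓝 (maximalFunction Θ γ f x)) := by
    simpa using ENNReal.Tendsto.sub (tendsto_const_nhds (x := maximalFunction Θ γ f x)) htail
      (Or.inl hfin)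
  have hup : Tendsto (fun k => maximalFunction Θ γ f x + ∑' n, M (n + k)) atTop
      (𝓝 (maximalFunction Θ γ f x)) := by
    simpa using (tendsto_const_nhds (x := maximalFunction Θ γ f x)).add htail
  refine tendsto_of_tendsto_of_tendsto_of_le_of_le hlow hup (fun k => ?_) (fun k => ?_)
  · refine tsub_le_iff_right.2 (supAlong_le fun t ht θ hθ => ?_)
    calc ‖schrodinger f t (γ x t θ)‖ₑ
        = ‖schrodingerTrunc f k t (γ x t θ) +
          (schrodinger f t (γ x t θ) - schrodingerTrunc f k t (γ x t θ))‖ₑ := by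
          rw [add_sub_cancel]
      _ ≤ _ := (enorm_add_le _ _).trans (add_le_add (le_supAlong γ _ x ht hθ)
          (enorm_schrodinger_sub_trunc_le hh hx ht hθ k))
  · refine supAlong_le fun t ht θ hθ => ?_
    calc ‖schrodingerTrunc f k t (γ x t θ)‖ₑ
        = ‖schrodinger f t (γ x t θ) -
          (schrodinger f t (γ x t θ) - schrodingerTrunc f k t (γ x t θ))‖ₑ := by
          rw [sub_sub_cancel]
      _ ≤ _ := (enorm_sub_le).trans (add_le_add (le_supAlong γ (schrodinger f) x ht hθ)
          (enorm_schrodinger_sub_trunc_le hh hx ht hθ k))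

end Pointwise

/-! ### General exponents and the three regimes -/

/-- The maximal estimate into `L^{2q}`, with frequency loss `σ` for each of the parameter sets of
diameter `ℓ^{-m}` at frequencies `∼ ℓ`. -/
theorem maximalEstimate_of_exponents {Θ : Set ℝ} (hΘ : IsCompact Θ)
    {α C₁ C₂ C₃ q m σ s : ℝ} (hα : 0 < α)
    (hC₁ : 1 ≤ C₁) (hC₂ : 0 < C₂) (hC₃ : 0 < C₃) (hq1 : 1 ≤ q) (hq2 : q ≤ 2) (hαq : 2 * α ≤ q)
    (hm0 : 0 < m) (hmq : m ≤ q) (hσ : 1 / 2 ≤ 2 * σ) (hσα : 1 - 2 * α / q ≤ 2 * σ)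
    (hσm : 1 - m / q ≤ 2 * σ) (hs : σ + m * upperMinkowskiDim Θ / (2 * q) < s)
    (x₀ : ℝ) {r : ℝ} (hr : 0 < r) :
    MaximalEstimate Θ α C₁ C₂ C₃ x₀ r s (ENNReal.ofReal (2 * q)) := by
  have hq0 : 0 < q := by linarith
  have hs0 : 0 ≤ s := by
    have : 0 ≤ m * upperMinkowskiDim Θ / (2 * q) :=
      div_nonneg (mul_nonneg hm0.le (upperMinkowskiDim_nonneg hΘ)) (by positivity)
    linarith
  obtain ⟨C, hC⟩ := exists_lintegral_majorant_le hΘ hα hC₁ hC₂ hC₃ hq1 hq2 hαq hm0 hmq hσ hσα hσm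
    hs0 hs x₀ hr
  refine ⟨C ^ (1 / (2 * q)), fun γ hγ f hf => ?_⟩
  have hE := energy_lt_top_of_memH hf
  have hm := measurable_hat f
  have hh : ∀ R : ℝ, IntegrableOn (hat f) (Set.Icc (-R) R) := fun R =>
    integrableOn_of_energy_lt_top hs0 hm hE measure_Icc_lt_top
  have hmaj := hC γ hγ (hat f) hm hE
  have hcont : ∀ (E : Set ℝ), IntegrableOn (hat f) E → ∀ t,
      Continuous (bandIntegral E (hat f) t) := fun E hE t =>
    (continuous_bandIntegral hE).comp (by fun_prop : Continuous fun y : ℝ => (t, y))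
  have hmajm : Measurable (majorant Θ γ (hat f)) :=
    measurable_const.add (Measurable.tsum fun n => measurable_supAlong hγ
      (hcont _ (integrableOn_of_energy_lt_top hs0 hm hE (volume_annulus_lt_top _))))
  have hae : ∀ᵐ x ∂(volume.restrict (Metric.ball x₀ r)), majorant Θ γ (hat f) x ≠ ∞ := by
    have hfin : ∫⁻ x in Metric.ball x₀ r, majorant Θ γ (hat f) x ^ (2 * q) ≠ ∞ :=
      ne_top_of_le_ne_top (ENNReal.mul_ne_top ENNReal.coe_ne_top
        (ENNReal.rpow_ne_top_of_nonneg hq0.le hE.ne)) hmaj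
    filter_upwards [ae_lt_top (hmajm.pow_const _) hfin] with x hx hx'
    rw [hx', ENNReal.top_rpow_of_pos (by positivity)] at hx
    exact lt_irrefl _ hx
  refine ⟨?_, ?_, ?_⟩
  · filter_upwards [hae] with x hx t ht θ hθ
    exact schrodingerDefinedAt_of_majorant hh hx ht hθ
  · refine aemeasurable_of_tendsto_metrizable_ae atTop
      (f := fun k : ℕ => supAlong Θ γ (schrodingerTrunc f k)) (fun k => ?_) ?_
    · exact (measurable_supAlong hγ fun t => (hcont _ (hh _) t).const_mul _).aemeasurable
    · filter_upwards [hae] with x hx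
      exact tendsto_supAlong_schrodingerTrunc hh hx
  · rw [eLpNorm_eq_lintegral_rpow_enorm_toReal (by simpa using hq0) ENNReal.ofReal_ne_top,
      ENNReal.toReal_ofReal (by positivity), sobolevNorm_eq_energy_rpow]
    calc _ ≤ (C * energy s (hat f) ^ q) ^ (1 / (2 * q)) := by
          refine ENNReal.rpow_le_rpow (le_trans (lintegral_mono fun x => ?_) hmaj) (by positivity)
          rw [enorm_eq_self]
          exact ENNReal.rpow_le_rpow (maximalFunction_le_majorant hh) (by positivity)
      _ = _ := by
          rw [ENNReal.mul_rpow_of_nonneg _ _ (by positivity), ← ENNReal.rpow_mul,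
            ENNReal.coe_rpow_of_nonneg _ (by positivity)]
          congr 2
          field_simp

end SchrodingerCurves

theorem mainTheorem3 (Θ : Set ℝ) (hΘ : IsCompact Θ) (α C₁ C₂ C₃ : ℝ)
    (hC₁ : 1 ≤ C₁) (hC₂ : 0 < C₂) (hC₃ : 0 < C₃) (x₀ r : ℝ) (hr : 0 < r) :
    (α ∈ Set.Ico (1 / 2 : ℝ) 1 →
      ∀ s : ℝ, (SchrodingerCurves.upperMinkowskiDim Θ + 1) / 4 < s →
        SchrodingerCurves.MaximalEstimate Θ α C₁ C₂ C₃ x₀ r s 4) ∧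
    (α ∈ Set.Ioo (1 / 4 : ℝ) (1 / 2) →
      ∀ s : ℝ, (SchrodingerCurves.upperMinkowskiDim Θ + 1) / 4 < s →
        SchrodingerCurves.MaximalEstimate Θ α C₁ C₂ C₃ x₀ r s (ENNReal.ofReal (8 * α))) ∧
    (α ∈ Set.Ioc (0 : ℝ) (1 / 4) →
      ∀ s : ℝ, α * SchrodingerCurves.upperMinkowskiDim Θ + 1 / 2 - α < s →
        SchrodingerCurves.MaximalEstimate Θ α C₁ C₂ C₃ x₀ r s 2) := by
  refine ⟨fun hα s hs => ?_, fun hα s hs => ?_, fun hα s hs => ?_⟩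
  · have hα1 := hα.1
    have hα2 := hα.2
    -- σ = 1/4 is the least loss allowed. The largest q, namely 2, is admissible since 1 - α ≤ 1/2,
    -- and m = q/2 is the least m with 1 - m/q ≤ 1/2.
    have h := SchrodingerCurves.maximalEstimate_of_exponents hΘ (α := α) (q := 2) (m := 1)
      (σ := 1 / 4) (s := s) (by linarith) hC₁ hC₂ hC₃ (by norm_num) (by norm_num) (by linarith)
      (by norm_num) (by norm_num) (by norm_num) (by linarith) (by norm_num) (by linarith) x₀ hr
    have h4 : ENNReal.ofReal (2 * 2) = 4 := by norm_num
    rwa [h4] at h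
  · have hα1 := hα.1
    have hα2 := hα.2
    have hα0 : 0 < α := by linarith
    have e1 : 2 * α / (4 * α) = 1 / 2 := by field_simp; norm_num
    have e2 : 2 * α * SchrodingerCurves.upperMinkowskiDim Θ / (2 * (4 * α)) =
        SchrodingerCurves.upperMinkowskiDim Θ / 4 := by field_simp
    -- Keeping σ = 1/4 forces 1 - 2α/q ≤ 1/2, so q = 4α is the largest choice; again m = q/2.
    have h := SchrodingerCurves.maximalEstimate_of_exponents hΘ (α := α) (q := 4 * α)
      (m := 2 * α) (σ := 1 / 4) (s := s) hα0 hC₁ hC₂ hC₃ (by linarith) (by linarith)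
      (by linarith) (by linarith) (by linarith) (by norm_num) (by rw [e1]; norm_num)
      (by rw [e1]; norm_num) (by rw [e2]; linarith) x₀ hr
    have h8 : 2 * (4 * α) = 8 * α := by ring
    rwa [h8] at h
  · have hα1 := hα.1
    have hα2 := hα.2
    -- Now 4α ≤ 1, so q sits at its lower limit 1. The time term forces 2σ = 1 - 2α, and m = 2α is
    -- the least m that costs no more.
    have h := SchrodingerCurves.maximalEstimate_of_exponents hΘ (α := α) (q := 1)
      (m := 2 * α) (σ := 1 / 2 - α) (s := s) hα1 hC₁ hC₂ hC₃ (by norm_num) (by norm_num)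
      (by linarith) (by linarith) (by linarith) (by linarith) (by linarith) (by linarith)
      (by linarith) x₀ hr
    have h2 : ENNReal.ofReal (2 * 1) = 2 := by norm_num
    rwa [h2] at h
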